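/- Let $F_3=\langle\alpha,\beta,\gamma,\delta\mid\alpha\beta\gamma\delta\rangle$ be the fundamental group of the four-holed sphere and let $\boldsymbol\mu=(p,q,r,s)\in\mathbb R^4$. Let $\Sigma$ be the trivalent tree dual to the Farey triangulation, with edges coloured $1,2,3$ so that the three edges at each vertex have different colours and the boundary of each complementary region alternates between two colours; the region receives the third colour. Let $\Omega$ be the set of complementary regions. A $\boldsymbol\mu$-Markoff map is a function $\phi:\Omega\to\mathbb C$ such that, at every vertex, the values $x,y,z$ on the adjacent regions of colours $1,2,3$ form a $\boldsymbol\mu$-Markoff triple, i.e. satisfy $x^2+y^2+z^2+xyz=px+qy+rz+s$, and, across an edge of colour $1$, $2$, $3$ respectively, $x+x'=p-yz$, $y+y'=q-xz$, $z+z'=r-xy$. It is determined by the triple at a base vertex. It satisfies the BQ-conditions with constant $K$ if $\phi(X)\notin[-2,2]$ for all $X\in\Omega$ and $|\phi(X)|\le K$ for only finitely many $X\in\Omega$. Let the mapping class group $\mathcal{MCG}$ be the group of even-length words in $\mathbb Z_2*\mathbb Z_2*\mathbb Z_2$, acting on the variety $V_{\boldsymbol\mu}\subset\mathbb C^3$ of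 $\boldsymbol\mu$-Markoff triples through the three involutions $(x,y,z)\mapsto(p-yz-x,y,z)$, $(x,q-xz-y,z)$, $(x,y,r-xy-z)$. A domain of discontinuity is a non-empty $\mathcal{MCG}$-invariant relatively open subset $U\subset V_{\boldsymbol\mu}$ on which $\mathcal{MCG}$ acts properly discontinuously: $\{g\in\mathcal{MCG}: gC\cap C\ne\emptyset\}$ is finite for every compact $C\subset U$. **Theorem.** Suppose $(p,q,r)\neq(0,0,0)$. Then there is a real-valued $\boldsymbol\mu$-Markoff map that satisfies the BQ-conditions with every constant $K$. Hence there is a domain of discontinuity $U\subset V_{\boldsymbol\mu}$, all of whose points are base triples of $\boldsymbol\mu$-Markoff maps satisfying the BQ-conditions with every constant $K$, such that $U\cap\mathbb R^3\neq\emptyset$, and such that for all $(a,b,c,d)\in\mathbb R^4$ with $p=ab+cd$, $q=bc+ad$, $r=ac+bd$, $s=4-a^2-b^2-c^2-d^2-abcd$ the following hold. 1. There is a representation $\rho:F_3\to\mathrm{SL}(2,\mathbb R)$ whose values at $\alpha,\beta,\gamma,\delta$ have traces $a,b,c,d$ and with $(\operatorname{tr}\rho(\alpha\beta),\operatorname{tr}\rho(\beta\gamma),\operatorname{tr}\rho(\alpha\gamma))\in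 U$. 2. If $|a|,|b|,|c|,|d|>2$ and $abcd<0$, then for each $e\in\{1,-1\}$ there is such a $\rho$ with relative Euler class $e$ (which is not maximal, the maximal classes being $\pm2$). Here the relative Euler class is the integer translation obtained as the product of the canonical lifts (those with a fixed point) of $\rho(\alpha),\rho(\beta),\rho(\gamma),\rho(\delta)$ to the universal cover of $\mathrm{PSL}(2,\mathbb R)$ acting on the universal cover of $\mathbb{RP}^1$, normalised so that the generator of the deck group is translation by $1$. -/

import Mathlib

open scoped MatrixGroups

namespace FourHoledSphere

/-! ## The coloured trivalent tree and its complementary regions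

The group `W = ℤ/2 * ℤ/2 * ℤ/2` is generated by the reflections in the sides of an ideal triangle.
Its Cayley graph is the trivalent tree `Σ` dual to the Farey triangulation: the vertices are the
elements `w` of `W`, and the edge of colour `i` at `w` joins `w` to `w * gen i`.  The boundary of a
complementary region of colour `i` is a bi-infinite path whose edges alternate between the two
other colours, so the vertices on it form a left coset of `⟨gen j : j ≠ i⟩`.
The colours `1, 2, 3` are written `0, 1, 2 : Fin 3`. -/

/-- The free product `ℤ/2 * ℤ/2 * ℤ/2`, whose elements are the vertices of the tree. -/
abbrev W : Type := Monoid.CoprodI (fun _ : Fin 3 => Multiplicative (ZMod 2))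

/-- The three generating reflections. -/
def gen (i : Fin 3) : W :=
  Monoid.CoprodI.of (M := fun _ : Fin 3 => Multiplicative (ZMod 2)) (i := i)
    (Multiplicative.ofAdd 1)

/-- The stabiliser of the region of colour `i` at the vertex `1`. -/
def regionStabilizer (i : Fin 3) : Subgroup W :=
  Subgroup.closure {g | ∃ j, j ≠ i ∧ g = gen j}

/-- The complementary regions of the tree, each with its colour. -/
abbrev Region : Type := Σ i : Fin 3, W ⧸ regionStabilizer i

/-- The region of colour `i` that meets the vertex `w`. -/
def regionAt (i : Fin 3) (w : W) : Region := ⟨i, (w : W ⧸ regionStabilizer i)⟩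

/-! ## Markoff triples and Markoff maps -/

/-- The parameters `μ = (p, q, r, s)`. -/
@[ext]
structure Param where
  p : ℂ
  q : ℂ
  r : ℂ
  s : ℂ

/-- The `μ`-Markoff equation for `(x, y, z) = (t 0, t 1, t 2)`. -/
def IsMarkoffTriple (μ : Param) (t : Fin 3 → ℂ) : Prop :=
  t 0 ^ 2 + t 1 ^ 2 + t 2 ^ 2 + t 0 * t 1 * t 2 = μ.p * t 0 + μ.q * t 1 + μ.r * t 2 + μ.s

/-- The values of `φ` on the regions of colours `1, 2, 3` that meet the vertex `w`. -/
def valuesAt (φ : Region → ℂ) (w : W) : Fin 3 → ℂ := fun i => φ (regionAt i w)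

/-- `μ`-Markoff maps: the vertex relation at every vertex, and the edge relation along every edge
of each of the three colours. -/
structure IsMarkoffMap (μ : Param) (φ : Region → ℂ) : Prop where
  vertex : ∀ w : W, IsMarkoffTriple μ (valuesAt φ w)
  edge_one : ∀ w : W, φ (regionAt 0 w) + φ (regionAt 0 (w * gen 0)) =
    μ.p - φ (regionAt 1 w) * φ (regionAt 2 w)
  edge_two : ∀ w : W, φ (regionAt 1 w) + φ (regionAt 1 (w * gen 1)) =
    μ.q - φ (regionAt 0 w) * φ (regionAt 2 w)
  edge_three : ∀ w : W, φ (regionAt 2 w) + φ (regionAt 2 (w * gen 2)) =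
    μ.r - φ (regionAt 0 w) * φ (regionAt 1 w)

/-- All values of `φ` are real. -/
def IsRealMap (φ : Region → ℂ) : Prop := ∀ X, ∃ x : ℝ, φ X = (x : ℂ)

/-- The set `Ω_φ(k)`. -/
def sublevel (φ : Region → ℂ) (k : ℝ) : Set Region := {X | ‖φ X‖ ≤ k}

/-- The BQ-conditions with constant `K`. -/
structure SatisfiesBQ (K : ℝ) (φ : Region → ℂ) : Prop where
  bq_one : ∀ X, φ X ∉ (fun x : ℝ => (x : ℂ)) '' Set.Icc (-2) 2
  bq_two : (sublevel φ K).Finite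

/-- The triple `t` is the triple at the base vertex of a `μ`-Markoff map (which it determines) that
satisfies the BQ-conditions, whatever the constant. -/
def IsBowditchTriple (μ : Param) (t : Fin 3 → ℂ) : Prop :=
  ∃ φ : Region → ℂ, IsMarkoffMap μ φ ∧ valuesAt φ 1 = t ∧ ∀ K : ℝ, SatisfiesBQ K φ

/-! ## The action of the mapping class group -/

/-- The elementary operations `θ₁, θ₂, θ₃`. -/
def theta (μ : Param) : Fin 3 → (Fin 3 → ℂ) → (Fin 3 → ℂ)
  | 0, t => ![μ.p - t 1 * t 2 - t 0, t 1, t 2]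
  | 1, t => ![t 0, μ.q - t 0 * t 2 - t 1, t 2]
  | 2, t => ![t 0, t 1, μ.r - t 0 * t 1 - t 2]

theorem theta_involutive (μ : Param) (i : Fin 3) : Function.Involutive (theta μ i) := by
  intro t
  fin_cases i <;> ext j <;> fin_cases j <;> simp [theta]

/-- An involution as an action of `ℤ/2`. -/
def involutionHom {α : Type*} (f : α → α) (hf : Function.Involutive f) :
    Multiplicative (ZMod 2) →* Equiv.Perm α where
  toFun g := if g = 1 then 1 else hf.toPerm f
  map_one' := by simp
  map_mul' g h := by
    have key : ∀ g : Multiplicative (ZMod 2), g = 1 ∨ g = Multiplicative.ofAdd 1 := by decide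
    have h1 : (Multiplicative.ofAdd (1 : ZMod 2)) ≠ 1 := by decide
    have h2 : Multiplicative.ofAdd (1 : ZMod 2) * Multiplicative.ofAdd 1 = 1 := by decide
    have h3 : hf.toPerm f * hf.toPerm f = 1 := by
      ext x
      exact hf x
    rcases key g with rfl | rfl <;> rcases key h with rfl | rfl <;> simp [h1, h2, h3]

/-- The action of `W` on `ℂ³` in which the generators act by `θ₁, θ₂, θ₃`. -/
def thetaHom (μ : Param) : W →* Equiv.Perm (Fin 3 → ℂ) :=
  Monoid.CoprodI.lift fun i => involutionHom (theta μ i) (theta_involutive μ i)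

/-- The parity of the length of a word in the generators. -/
def parity : W →* Multiplicative (ZMod 2) :=
  Monoid.CoprodI.lift fun _ => MonoidHom.id _

/-- The mapping class group of the four-holed sphere, as the group of words of even length in the
three reflections; it is generated by `gen 1 * gen 2`, `gen 2 * gen 0`, `gen 0 * gen 1`, which
act as the Dehn twists about three simple closed curves. -/
def MCG : Subgroup W := parity.ker

/-- `U` is a domain of discontinuity in the relative character variety (identified with the set of
`μ`-Markoff triples): it is a non-empty relatively open subset, invariant under the mapping class
group, on which the mapping class group acts properly discontinuously. -/
structure IsDomainOfDiscontinuity (μ : Param) (U : Set (Fin 3 → ℂ)) : Prop where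
  nonempty : U.Nonempty
  relOpen : ∃ O : Set (Fin 3 → ℂ), IsOpen O ∧ U = O ∩ {t | IsMarkoffTriple μ t}
  invariant : ∀ g ∈ MCG, ∀ t ∈ U, thetaHom μ g t ∈ U
  properlyDiscontinuous : ∀ C : Set (Fin 3 → ℂ), C ⊆ U → IsCompact C →
    {g : W | g ∈ MCG ∧ (thetaHom μ g '' C ∩ C).Nonempty}.Finite

/-! ## Representations and the relative Euler class -/

/-- The map `(a, b, c, d) ↦ (p, q, r, s)`. -/
def paramOf (a b c d : ℝ) : Param where
  p := a * b + c * d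
  q := b * c + a * d
  r := a * c + b * d
  s := 4 - a ^ 2 - b ^ 2 - c ^ 2 - d ^ 2 - a * b * c * d

/-- The fundamental group `⟨α, β, γ, δ | αβγδ⟩` of the four-holed sphere, which is free on
`α, β, γ`. -/
abbrev SurfaceGroup : Type := FreeGroup (Fin 3)

/-- The boundary elements `α, β, γ, δ`, with `αβγδ = 1`. -/
def boundary : Fin 4 → SurfaceGroup :=
  ![FreeGroup.of 0, FreeGroup.of 1, FreeGroup.of 2,
    (FreeGroup.of 0 * FreeGroup.of 1 * FreeGroup.of 2)⁻¹]

/-- The trace of an element in a representation. -/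
def tr (ρ : SurfaceGroup →* SL(2, ℝ)) (g : SurfaceGroup) : ℝ :=
  (ρ g : Matrix (Fin 2) (Fin 2) ℝ).trace

/-- `ρ` is a `τ`-representation for `τ = (a, b, c, d)`. -/
def IsTauRep (a b c d : ℝ) (ρ : SurfaceGroup →* SL(2, ℝ)) : Prop :=
  tr ρ (boundary 0) = a ∧ tr ρ (boundary 1) = b ∧ tr ρ (boundary 2) = c ∧ tr ρ (boundary 3) = d

/-- The coordinates `(tr ρ(αβ), tr ρ(βγ), tr ρ(αγ))` of `ρ` in the relative character variety. -/
def character (ρ : SurfaceGroup →* SL(2, ℝ)) : Fin 3 → ℂ :=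
  ![(tr ρ (boundary 0 * boundary 1) : ℂ), (tr ρ (boundary 1 * boundary 2) : ℂ),
    (tr ρ (boundary 0 * boundary 2) : ℂ)]

/-- The unit vector of angle `π t`; `t ↦ ℝ · direction t` is the universal covering of the
projective line. -/
noncomputable def direction (t : ℝ) : Fin 2 → ℝ := ![Real.cos (Real.pi * t), Real.sin (Real.pi * t)]

/-- `f` is a lift to `ℝ` of the action of `A` on the projective line, that is, an element of the
universal cover of `PSL(2, ℝ)` over the class of `A`. -/
def IsLift (A : SL(2, ℝ)) (f : ℝ → ℝ) : Prop :=
  Continuous f ∧ ∀ t, ∃ c : ℝ,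
    (A : Matrix (Fin 2) (Fin 2) ℝ).mulVec (direction t) = c • direction (f t)

/-- The relative Euler class of a representation with hyperbolic boundary: the product of the
canonical lifts of the boundary elements (those with a fixed point) is the translation by `e`. -/
def HasRelativeEulerClass (ρ : SurfaceGroup →* SL(2, ℝ)) (e : ℤ) : Prop :=
  ∃ f : Fin 4 → ℝ → ℝ, (∀ i, IsLift (ρ (boundary i)) (f i) ∧ ∃ t, f i t = t) ∧
    ∀ t, f 0 (f 1 (f 2 (f 3 t))) = t + e

end FourHoledSphere

namespace FourHoledSphere

open Filter Topology

/-! ### The linear coefficients and the elementary operations -/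

/-! The point is to find real Markoff maps with one value slightly outside `[-2, 2]` and all others
large. Fix a region of colour `k` with value of modulus `u = 2 + ε`, and let its neighbours, of
colours `i` and `j`, have coefficients of moduli `a` and `b`. With the right signs, the moduli of
the neighbours satisfy `v' = u v - v'' - a`, or the same with `b`, so the second difference is `ε v
- a` or `ε v - b`. If two adjacent neighbours have size about `T`, the Markoff equation forces `ε T`
to be close to `a + b`. When `a + b > 0`, the sequence then grows in both directions by at least a
fixed amount at each step. This is where `(p, q, r) ≠ 0` enters. Away from this boundary path, each
new value is dominated by the product of two large ones. The inequalities are strict and involve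
norms only, so they hold on an open set of complex triples, with bounds depending only on word
length (`growth_of_mem_basin`, `uniformBQ_basin`).

Proper discontinuity follows from these uniform bounds: if `g` brings a compact set back to itself,
the three regions at the vertex `g⁻¹` carry bounded values, so they lie in a finite set, and they
determine `g`.

A real triple whose first entry has modulus above 2 is the character of a representation into `SL(2,
ℝ)`, which can be written down after diagonalising the image of `αβ` (`exists_matrices_of_traces`).
For the Euler class, `abcd < 0` makes the translation odd, and the displacement bounds of the
canonical lifts make it smaller than 3 in absolute value, so it is `1` or `-1`. Conjugation by a
reflection exchanges the two without changing the character. -/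

/-- The vector `(p, q, r)`. -/
def Param.coeff (μ : Param) : Fin 3 → ℂ := ![μ.p, μ.q, μ.r]

theorem theta_apply_self (μ : Param) {i j k : Fin 3} (hij : i ≠ j) (hik : i ≠ k) (hjk : j ≠ k)
    (t : Fin 3 → ℂ) : theta μ i t i = μ.coeff i - t j * t k - t i := by
  fin_cases i <;> fin_cases j <;> fin_cases k <;> simp_all [theta, Param.coeff] <;>
    ring

theorem theta_apply_of_ne (μ : Param) {i j : Fin 3} (hij : j ≠ i) (t : Fin 3 → ℂ) :
    theta μ i t j = t j := by
  fin_cases i <;> fin_cases j <;> simp_all [theta]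

theorem isMarkoffTriple_iff (μ : Param) {i j k : Fin 3} (hij : i ≠ j) (hik : i ≠ k) (hjk : j ≠ k)
    (t : Fin 3 → ℂ) : IsMarkoffTriple μ t ↔
      t i ^ 2 + t j ^ 2 + t k ^ 2 + t i * t j * t k =
        μ.coeff i * t i + μ.coeff j * t j + μ.coeff k * t k + μ.s := by
  unfold IsMarkoffTriple
  fin_cases i <;> fin_cases j <;> fin_cases k <;> simp_all [Param.coeff] <;>
    constructor <;> intro h <;> linear_combination h

theorem IsMarkoffTriple.theta {μ : Param} {t : Fin 3 → ℂ} (ht : IsMarkoffTriple μ t) (i : Fin 3) :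
    IsMarkoffTriple μ (theta μ i t) := by
  have h1 : i ≠ i + 1 := by fin_cases i <;> decide
  have h2 : i ≠ i + 2 := by fin_cases i <;> decide
  have h3 : i + 1 ≠ i + 2 := by fin_cases i <;> decide
  rw [isMarkoffTriple_iff μ h1 h2 h3] at ht ⊢
  rw [theta_apply_self μ h1 h2 h3, theta_apply_of_ne μ h1.symm, theta_apply_of_ne μ h2.symm]
  linear_combination ht

theorem continuous_theta (μ : Param) (i : Fin 3) : Continuous (theta μ i) := by
  refine continuous_pi fun j => ?_
  by_cases hij : j = i
  · subst hij
    have h1 : j ≠ j + 1 := by fin_cases j <;> decide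
    have h2 : j ≠ j + 2 := by fin_cases j <;> decide
    have h3 : j + 1 ≠ j + 2 := by fin_cases j <;> decide
    simp only [theta_apply_self μ h1 h2 h3]
    fun_prop
  · simp only [theta_apply_of_ne μ hij]
    fun_prop

/-! ### Words in the reflections -/

theorem gen_mul_self (i : Fin 3) : gen i * gen i = 1 := by
  rw [gen, ← map_mul, show Multiplicative.ofAdd (1 : ZMod 2) * Multiplicative.ofAdd 1 = 1 by decide,
    map_one]

theorem gen_inv (i : Fin 3) : (gen i)⁻¹ = gen i := inv_eq_of_mul_eq_one_left (gen_mul_self i)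

theorem thetaHom_gen (μ : Param) (i : Fin 3) (t : Fin 3 → ℂ) :
    thetaHom μ (gen i) t = theta μ i t := by
  have h1 : (Multiplicative.ofAdd (1 : ZMod 2)) ≠ 1 := by decide
  simp [thetaHom, gen, involutionHom, h1]

theorem thetaHom_mul (μ : Param) (g h : W) (t : Fin 3 → ℂ) :
    thetaHom μ (g * h) t = thetaHom μ g (thetaHom μ h t) := by
  rw [map_mul]; rfl

theorem thetaHom_one (μ : Param) (t : Fin 3 → ℂ) : thetaHom μ 1 t = t := by
  rw [map_one]; rfl

/-- Induction on words, adding letters on the right. -/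
theorem word_induction {P : W → Prop} (one : P 1) (mul_gen : ∀ w i, P w → P (w * gen i)) (w : W) :
    P w := by
  suffices h : ∀ v, P v → P (v * w) by simpa using h 1 one
  induction w using Monoid.CoprodI.induction_on with
  | one => simp
  | of i m =>
    intro v hv
    have key : ∀ g : Multiplicative (ZMod 2), g = 1 ∨ g = Multiplicative.ofAdd 1 := by decide
    rcases key m with rfl | rfl
    · simpa using hv
    · exact mul_gen v i hv
  | mul x y hx hy =>
    intro v hv
    rw [← mul_assoc]
    exact hy _ (hx _ hv)

/-- The vertex reached from the base vertex along a path, whose colours are listed last first. -/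
def vertexOf : List (Fin 3) → W
  | [] => 1
  | i :: L => vertexOf L * gen i

/-- The triple reached from `t` along a path, whose colours are listed last first. -/
def run (μ : Param) (t : Fin 3 → ℂ) : List (Fin 3) → Fin 3 → ℂ
  | [] => t
  | i :: L => theta μ i (run μ t L)

/-- The inverse appears because a step along the tree multiplies the vertex on the right, whereas
the corresponding move is applied to the triple last, hence on the left. -/
theorem thetaHom_vertexOf_inv (μ : Param) (t : Fin 3 → ℂ) (L : List (Fin 3)) :
    thetaHom μ (vertexOf L)⁻¹ t = run μ t L := by
  induction L with
  | nil => simp [vertexOf, run]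
  | cons i L ih => rw [vertexOf, mul_inv_rev, gen_inv, thetaHom_mul, ih, thetaHom_gen, run]

theorem exists_reduced_word (w : W) : ∃ L : List (Fin 3), L.IsChain (· ≠ ·) ∧ vertexOf L = w := by
  induction w using word_induction with
  | one => exact ⟨[], List.isChain_nil, rfl⟩
  | mul_gen w i h =>
    obtain ⟨L, hL, rfl⟩ := h
    cases L with
    | nil => exact ⟨[i], List.isChain_singleton i, rfl⟩
    | cons j L =>
      by_cases hij : i = j
      · subst hij
        exact ⟨L, hL.tail, by rw [vertexOf, mul_assoc, gen_mul_self, mul_one]⟩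
      · exact ⟨i :: j :: L, List.isChain_cons_cons.2 ⟨hij, hL⟩, rfl⟩

theorem continuous_thetaHom (μ : Param) (g : W) : Continuous (thetaHom μ g) := by
  induction g using word_induction with
  | one => simpa [thetaHom_one] using continuous_id
  | mul_gen w i h =>
    have : ⇑(thetaHom μ (w * gen i)) = thetaHom μ w ∘ theta μ i := by
      ext t : 1
      rw [thetaHom_mul, thetaHom_gen]; rfl
    rw [this]
    exact h.comp (continuous_theta μ i)

theorem IsMarkoffTriple.thetaHom {μ : Param} {t : Fin 3 → ℂ} (ht : IsMarkoffTriple μ t) (g : W) :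
    IsMarkoffTriple μ (thetaHom μ g t) := by
  obtain ⟨L, -, hL⟩ := exists_reduced_word g⁻¹
  rw [← inv_inv g, ← hL, thetaHom_vertexOf_inv]
  clear hL
  induction L with
  | nil => exact ht
  | cons i L ih => exact ih.theta i

/-! ### Regions -/

theorem gen_mem_regionStabilizer {i j : Fin 3} (h : j ≠ i) : gen j ∈ regionStabilizer i :=
  Subgroup.subset_closure ⟨j, h, rfl⟩

theorem regionAt_mul_gen {i j : Fin 3} (h : j ≠ i) (w : W) :
    regionAt i (w * gen j) = regionAt i w := by
  have : ((w * gen j : W) : W ⧸ regionStabilizer i) = (w : W ⧸ regionStabilizer i) := by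
    rw [eq_comm, QuotientGroup.eq]
    simpa using gen_mem_regionStabilizer h
  simp only [regionAt, this]

/-- Dropping the final letters that do not leave the region gives its vertex of first entry. Its
value is then an entry of the base triple or the entry changed by the last move, so growth need only
be tracked for the newest entry. -/
theorem exists_reduced_word_region (X : Region) : ∃ (l : Fin 3) (L : List (Fin 3)),
    L.IsChain (· ≠ ·) ∧ X = regionAt l (vertexOf L) ∧ ∀ i ∈ L.head?, i = l := by
  obtain ⟨l, x⟩ := X
  obtain ⟨w, rfl⟩ := QuotientGroup.mk_surjective x
  obtain ⟨L, hL, rfl⟩ := exists_reduced_word w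
  refine ⟨l, ?_⟩
  change ∃ L', _ ∧ regionAt l (vertexOf L) = _ ∧ _
  induction L with
  | nil => exact ⟨[], hL, rfl, by simp⟩
  | cons i L ih =>
    by_cases hil : i = l
    · exact ⟨i :: L, hL, rfl, by simpa using hil⟩
    · obtain ⟨L', h1, h2, h3⟩ := ih hL.tail
      exact ⟨L', h1, by rw [vertexOf, regionAt_mul_gen hil, h2], h3⟩

/-- The retraction of `W` that kills one generator. -/
def killGen (i : Fin 3) : W →* W :=
  Monoid.CoprodI.lift fun j => if j = i then 1 else
    Monoid.CoprodI.of (M := fun _ : Fin 3 => Multiplicative (ZMod 2)) (i := j)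

theorem killGen_gen (i j : Fin 3) : killGen i (gen j) = if j = i then 1 else gen j := by
  unfold killGen gen
  rw [Monoid.CoprodI.lift_of]
  split_ifs <;> rfl

theorem killGen_of_mem {i : Fin 3} {g : W} (hg : g ∈ regionStabilizer i) : killGen i g = g := by
  have : regionStabilizer i ≤ (killGen i).eqLocus (MonoidHom.id W) := by
    rw [regionStabilizer, Subgroup.closure_le]
    rintro _ ⟨j, hj, rfl⟩
    change killGen i (gen j) = gen j
    rw [killGen_gen, if_neg hj]
  exact this hg

/-- A vertex is determined by the three regions that meet it. -/
theorem eq_of_regionAt_eq {v w : W} (h : ∀ i, regionAt i v = regionAt i w) : v = w := by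
  have hmem : ∀ i, v⁻¹ * w ∈ regionStabilizer i := fun i => by
    have := h i
    simp only [regionAt, Sigma.mk.injEq, heq_eq_eq, true_and] at this
    exact QuotientGroup.eq.1 this
  -- An element of all three stabilisers is fixed by each retraction, while the three together kill
  -- every generator.
  have hkill : ∀ g : W, killGen 0 (killGen 1 (killGen 2 g)) = 1 := fun g => by
    induction g using word_induction with
    | one => simp
    | mul_gen w i h =>
      rw [map_mul, map_mul, map_mul, h, one_mul]
      fin_cases i <;> simp [killGen_gen]
  have := hkill (v⁻¹ * w)
  rw [killGen_of_mem (hmem 2), killGen_of_mem (hmem 1), killGen_of_mem (hmem 0)] at this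
  exact inv_mul_eq_one.1 this

/-! ### The Markoff map with a given base triple -/

/-- This makes the value constant along the boundary of a region, so that `markoffMap` is well
defined on cosets. -/
theorem thetaHom_apply_of_mem (μ : Param) {i : Fin 3} {g : W} (hg : g ∈ regionStabilizer i)
    (t : Fin 3 → ℂ) : thetaHom μ g t i = t i := by
  induction hg using Subgroup.closure_induction generalizing t with
  | mem g h =>
    obtain ⟨j, hj, rfl⟩ := h
    rw [thetaHom_gen, theta_apply_of_ne μ hj.symm]
  | one => rw [thetaHom_one]
  | mul g h _ _ hg hh => rw [thetaHom_mul, hg, hh]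
  | inv g _ hg =>
    rw [← hg (thetaHom μ g⁻¹ t), ← thetaHom_mul, mul_inv_cancel, thetaHom_one]

/-- The Markoff map with base triple `t`. -/
def markoffMap (μ : Param) (t : Fin 3 → ℂ) : Region → ℂ := fun X =>
  Quotient.liftOn' X.2 (fun w => thetaHom μ w⁻¹ t X.1) fun v w h => by
    rw [QuotientGroup.leftRel_apply] at h
    have : thetaHom μ w⁻¹ t = thetaHom μ (v⁻¹ * w)⁻¹ (thetaHom μ v⁻¹ t) := by
      rw [← thetaHom_mul]; group
    simp only [this]
    exact (thetaHom_apply_of_mem μ (inv_mem h) _).symm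

theorem markoffMap_regionAt (μ : Param) (t : Fin 3 → ℂ) (i : Fin 3) (w : W) :
    markoffMap μ t (regionAt i w) = thetaHom μ w⁻¹ t i := rfl

theorem valuesAt_markoffMap (μ : Param) (t : Fin 3 → ℂ) (w : W) :
    valuesAt (markoffMap μ t) w = thetaHom μ w⁻¹ t := rfl

theorem isMarkoffMap_markoffMap {μ : Param} {t : Fin 3 → ℂ} (ht : IsMarkoffTriple μ t) :
    IsMarkoffMap μ (markoffMap μ t) where
  vertex w := ht.thetaHom _
  edge_one w := by
    simp only [markoffMap_regionAt, mul_inv_rev, gen_inv, thetaHom_mul, thetaHom_gen]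
    simp [theta]
  edge_two w := by
    simp only [markoffMap_regionAt, mul_inv_rev, gen_inv, thetaHom_mul, thetaHom_gen]
    simp [theta]
  edge_three w := by
    simp only [markoffMap_regionAt, mul_inv_rev, gen_inv, thetaHom_mul, thetaHom_gen]
    simp [theta]

/-- `W` acts on regions. -/
def smulRegion (g : W) (X : Region) : Region := ⟨X.1, g • X.2⟩

theorem smulRegion_regionAt (g : W) (i : Fin 3) (w : W) :
    smulRegion g (regionAt i w) = regionAt i (g * w) := rfl

theorem smulRegion_inv_smulRegion (g : W) (X : Region) :
    smulRegion g⁻¹ (smulRegion g X) = X :=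
  Sigma.ext rfl (heq_of_eq (inv_smul_smul g X.2))

theorem markoffMap_thetaHom (μ : Param) (g : W) (t : Fin 3 → ℂ) (X : Region) :
    markoffMap μ (thetaHom μ g t) X = markoffMap μ t (smulRegion g⁻¹ X) := by
  obtain ⟨l, x⟩ := X
  obtain ⟨w, rfl⟩ := QuotientGroup.mk_surjective x
  change markoffMap μ _ (regionAt l w) = markoffMap μ t (smulRegion g⁻¹ (regionAt l w))
  rw [smulRegion_regionAt, markoffMap_regionAt, markoffMap_regionAt, ← thetaHom_mul]
  simp

theorem isRealMap_markoffMap (p q r s : ℝ) (t : Fin 3 → ℝ) :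
    IsRealMap (markoffMap ⟨p, q, r, s⟩ fun i => (t i : ℂ)) := by
  intro X
  obtain ⟨l, L, -, rfl, -⟩ := exists_reduced_word_region X
  rw [markoffMap_regionAt, thetaHom_vertexOf_inv]
  suffices h : ∃ x : Fin 3 → ℝ, run ⟨p, q, r, s⟩ (fun i => (t i : ℂ)) L = fun i => (x i : ℂ) by
    obtain ⟨x, hx⟩ := h
    exact ⟨x l, by rw [hx]⟩
  induction L with
  | nil => exact ⟨t, rfl⟩
  | cons i L ih =>
    obtain ⟨x, hx⟩ := ih
    rw [run, hx]
    fin_cases i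
    · exact ⟨![p - x 1 * x 2 - x 0, x 1, x 2], by ext j; fin_cases j <;> simp [theta]⟩
    · exact ⟨![x 0, q - x 0 * x 2 - x 1, x 2], by ext j; fin_cases j <;> simp [theta]⟩
    · exact ⟨![x 0, x 1, r - x 0 * x 1 - x 2], by ext j; fin_cases j <;> simp [theta]⟩

/-! ### The domain of discontinuity -/

/-- The BQ-conditions hold on `O` with all constants, and the sublevel sets stay in a finite set. -/
structure UniformBQ (μ : Param) (O : Set (Fin 3 → ℂ)) : Prop where
  avoid : ∀ t ∈ O, ∀ X, markoffMap μ t X ∉ (fun x : ℝ => (x : ℂ)) '' Set.Icc (-2) 2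
  finite : ∀ K : ℝ, ∃ F : Set Region, F.Finite ∧ ∀ t ∈ O, sublevel (markoffMap μ t) K ⊆ F

/-- The Markoff triples near which the BQ-conditions hold uniformly. -/
def bowditchDomain (μ : Param) : Set (Fin 3 → ℂ) :=
  {t | ∃ O, IsOpen O ∧ t ∈ O ∧ UniformBQ μ O} ∩ {t | IsMarkoffTriple μ t}

theorem isMarkoffTriple_of_mem_bowditchDomain {μ : Param} {t : Fin 3 → ℂ}
    (ht : t ∈ bowditchDomain μ) : IsMarkoffTriple μ t :=
  ht.2

theorem UniformBQ.preimage {μ : Param} {O : Set (Fin 3 → ℂ)} (h : UniformBQ μ O) (g : W) :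
    UniformBQ μ (thetaHom μ g ⁻¹' O) where
  avoid t ht X := by
    have := h.avoid _ ht (smulRegion g X)
    rwa [markoffMap_thetaHom, smulRegion_inv_smulRegion] at this
  finite K := by
    obtain ⟨F, hF, hsub⟩ := h.finite K
    refine ⟨smulRegion g⁻¹ '' F, hF.image _, fun t ht X hX => ⟨smulRegion g X, ?_, ?_⟩⟩
    · refine hsub _ ht ?_
      change ‖markoffMap μ (thetaHom μ g t) (smulRegion g X)‖ ≤ K
      rw [markoffMap_thetaHom, smulRegion_inv_smulRegion]
      exact hX
    · exact smulRegion_inv_smulRegion g X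

theorem thetaHom_mem_bowditchDomain {μ : Param} {t : Fin 3 → ℂ} (ht : t ∈ bowditchDomain μ)
    (g : W) : thetaHom μ g t ∈ bowditchDomain μ := by
  obtain ⟨⟨O, hO, htO, h⟩, htV⟩ := ht
  refine ⟨⟨thetaHom μ g⁻¹ ⁻¹' O, hO.preimage (continuous_thetaHom μ _), ?_, h.preimage _⟩,
    htV.thetaHom g⟩
  rw [Set.mem_preimage, ← thetaHom_mul, inv_mul_cancel, thetaHom_one]
  exact htO

theorem satisfiesBQ_of_mem_bowditchDomain {μ : Param} {t : Fin 3 → ℂ} (ht : t ∈ bowditchDomain μ)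
    (K : ℝ) : SatisfiesBQ K (markoffMap μ t) := by
  obtain ⟨⟨O, -, htO, h⟩, -⟩ := ht
  obtain ⟨F, hF, hsub⟩ := h.finite K
  exact ⟨h.avoid t htO, hF.subset (hsub t htO)⟩

theorem isBowditchTriple_of_mem_bowditchDomain {μ : Param} {t : Fin 3 → ℂ}
    (ht : t ∈ bowditchDomain μ) : IsBowditchTriple μ t :=
  ⟨markoffMap μ t, isMarkoffMap_markoffMap ht.2,
    by rw [valuesAt_markoffMap, inv_one, thetaHom_one], satisfiesBQ_of_mem_bowditchDomain ht⟩

theorem finite_sublevel_of_isCompact {μ : Param} {C : Set (Fin 3 → ℂ)} (hC : IsCompact C)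
    (hCU : C ⊆ bowditchDomain μ) (K : ℝ) :
    ∃ F : Set Region, F.Finite ∧ ∀ t ∈ C, sublevel (markoffMap μ t) K ⊆ F := by
  refine hC.induction_on (p := fun C => ∃ F : Set Region, F.Finite ∧
    ∀ t ∈ C, sublevel (markoffMap μ t) K ⊆ F) ⟨∅, Set.finite_empty, by simp⟩ ?_ ?_ ?_
  · rintro s t hst ⟨F, hF, h⟩
    exact ⟨F, hF, fun x hx => h x (hst hx)⟩
  · rintro s t ⟨F, hF, h⟩ ⟨F', hF', h'⟩
    refine ⟨F ∪ F', hF.union hF', fun x hx => ?_⟩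
    rcases hx with hx | hx
    · exact (h x hx).trans Set.subset_union_left
    · exact (h' x hx).trans Set.subset_union_right
  · intro t ht
    obtain ⟨⟨O, hO, htO, h⟩, -⟩ := hCU ht
    exact ⟨O, mem_nhdsWithin_of_mem_nhds (hO.mem_nhds htO), h.finite K⟩

theorem finite_of_regionAt_mem {F : Set Region} (hF : F.Finite) :
    {w : W | ∀ i, regionAt i w ∈ F}.Finite := by
  refine Set.Finite.of_finite_image (f := fun w i => regionAt i w)
    ((Set.Finite.pi' fun _ : Fin 3 => hF).subset ?_) ?_
  · rintro _ ⟨w, hw, rfl⟩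
    exact hw
  · intro v _ w _ h
    exact eq_of_regionAt_eq fun i => congrFun h i

/-- The entries of `thetaHom μ g t` are the values of the map of `t` at the vertex `g⁻¹`. Parity
plays no role, so all of `W` acts properly discontinuously. -/
theorem finite_of_image_inter_nonempty {μ : Param} {C : Set (Fin 3 → ℂ)} (hC : IsCompact C)
    (hCU : C ⊆ bowditchDomain μ) : {g : W | (thetaHom μ g '' C ∩ C).Nonempty}.Finite := by
  obtain ⟨K, hK⟩ := hC.isBounded.exists_norm_le
  obtain ⟨F, hF, hsub⟩ := finite_sublevel_of_isCompact hC hCU K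
  refine ((finite_of_regionAt_mem hF).preimage (f := fun g : W => g⁻¹)
    inv_injective.injOn).subset ?_
  rintro g ⟨_, ⟨t, ht, rfl⟩, ht'⟩ i
  refine hsub t ht ?_
  change ‖markoffMap μ t (regionAt i g⁻¹)‖ ≤ K
  rw [markoffMap_regionAt, inv_inv]
  exact (norm_le_pi_norm _ i).trans (hK _ ht')

theorem isDomainOfDiscontinuity_bowditchDomain {μ : Param} (h : (bowditchDomain μ).Nonempty) :
    IsDomainOfDiscontinuity μ (bowditchDomain μ) where
  nonempty := h
  relOpen := by
    refine ⟨_, ?_, rfl⟩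
    rw [isOpen_iff_mem_nhds]
    rintro t ⟨O, hO, htO, h⟩
    filter_upwards [hO.mem_nhds htO] with x hx using ⟨O, hO, hx, h⟩
  invariant g _ t ht := thetaHom_mem_bowditchDomain ht g
  properlyDiscontinuous C hCU hC :=
    (finite_of_image_inter_nonempty hC hCU).subset fun _ hg => hg.2

/-! ### Growth of the values along a path -/

/-- A lower bound for the values on all but one region. -/
noncomputable def Param.bound (μ : Param) : ℝ := 8 + ∑ i, ‖μ.coeff i‖

theorem Param.norm_coeff_add_le_bound (μ : Param) {i j : Fin 3} (hij : i ≠ j) :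
    8 + ‖μ.coeff i‖ + ‖μ.coeff j‖ ≤ μ.bound := by
  have h : ∑ l ∈ {i, j}, ‖μ.coeff l‖ ≤ ∑ l, ‖μ.coeff l‖ :=
    Finset.sum_le_sum_of_subset_of_nonneg (Finset.subset_univ _) fun _ _ _ => norm_nonneg _
  rw [Finset.sum_pair hij] at h
  unfold Param.bound
  linarith

theorem Param.norm_coeff_le_bound (μ : Param) (i : Fin 3) : 8 + ‖μ.coeff i‖ ≤ μ.bound := by
  have h := μ.norm_coeff_add_le_bound (i := i) (j := i + 1) (by fin_cases i <;> decide)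
  linarith [norm_nonneg (μ.coeff (i + 1))]

theorem le_norm_theta_apply_self (μ : Param) {i j k : Fin 3} (hij : i ≠ j) (hik : i ≠ k)
    (hjk : j ≠ k) (t : Fin 3 → ℂ) :
    ‖t j‖ * ‖t k‖ - ‖t i‖ - ‖μ.coeff i‖ ≤ ‖theta μ i t i‖ := by
  rw [theta_apply_self μ hij hik hjk, ← norm_mul]
  have h1 : t j * t k = (μ.coeff i - t i) - (μ.coeff i - t j * t k - t i) := by ring
  have h2 := norm_sub_le (μ.coeff i - t i) (μ.coeff i - t j * t k - t i)
  rw [← h1] at h2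
  have h3 := norm_sub_le (μ.coeff i) (t i)
  linarith

/-- The triple `t` is on the boundary path of a region of colour `k` and was reached along an edge
of colour `l`; the values on the neighbours of that region will grow if the path continues. -/
structure Spiral (μ : Param) (k l o : Fin 3) (t : Fin 3 → ℂ) : Prop where
  bound_lt : μ.bound < ‖t o‖
  lt_sub : (‖μ.coeff l‖ + ‖μ.coeff o‖) / 8 + ‖μ.coeff o‖ / 4 < ‖t l‖ - ‖t o‖
  lt_mul : 7 / 8 * (‖μ.coeff l‖ + ‖μ.coeff o‖) < (‖t k‖ - 2) * ‖t l‖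
  lt_three : ‖t k‖ < 3

/-- The triple `t` was reached along an edge of colour `l`; the values will grow if the path
continues. -/
def Escaping (μ : Param) (l : Fin 3) (t : Fin 3 → ℂ) : Prop :=
  ∀ m n, l ≠ m → l ≠ n → m ≠ n → μ.bound < ‖t m‖ ∧ ‖t m‖ * ‖t n‖ / 2 < ‖t l‖

theorem Spiral.bound_lt_last {μ : Param} {k l o : Fin 3} {t : Fin 3 → ℂ} (h : Spiral μ k l o t) :
    μ.bound + (‖μ.coeff l‖ + ‖μ.coeff o‖) / 8 < ‖t l‖ := by
  linarith [h.bound_lt, h.lt_sub, norm_nonneg (μ.coeff o)]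

theorem Spiral.two_lt {μ : Param} {k l o : Fin 3} {t : Fin 3 → ℂ} (h : Spiral μ k l o t) :
    2 < ‖t k‖ := by
  have h1 : 0 < (‖t k‖ - 2) * ‖t l‖ := lt_of_le_of_lt (by positivity) h.lt_mul
  linarith [pos_of_mul_pos_left h1 (norm_nonneg _)]

/-- Write `cₗ`, `cₒ` for the norms of the coefficients. The new gap is at least `(‖t k‖ - 2) ‖t l‖ +
(‖t l‖ - ‖t o‖) - cₒ`. The two lower bounds in `Spiral` make this exceed `7/8 (cₗ + cₒ) + (cₗ +
cₒ)/8 + cₒ/4 - cₒ = cₗ + cₒ/4`, which is at least the gap required next, `(cₗ + cₒ)/8 + cₗ/4`. -/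
theorem Spiral.step {μ : Param} {k l o : Fin 3} (hkl : k ≠ l) (hko : k ≠ o) (hlo : l ≠ o)
    {t : Fin 3 → ℂ} (h : Spiral μ k l o t) : Spiral μ k o l (theta μ o t) ∧
      ‖t l‖ + (‖μ.coeff l‖ + ‖μ.coeff o‖) / 8 ≤ ‖theta μ o t o‖ := by
  have h1 := le_norm_theta_apply_self μ hlo.symm hko.symm hkl.symm t
  have h2 := h.lt_sub
  have h3 := h.lt_mul
  have h4 := h.two_lt
  have h5 := norm_nonneg (μ.coeff o)
  have h6 := norm_nonneg (μ.coeff l)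
  have h7 : (‖μ.coeff o‖ + ‖μ.coeff l‖) / 8 + ‖μ.coeff l‖ / 4 < ‖theta μ o t o‖ - ‖t l‖ := by
    nlinarith
  refine ⟨⟨?_, ?_, ?_, ?_⟩, ?_⟩
  · rw [theta_apply_of_ne μ hlo]
    linarith [h.bound_lt_last]
  · rw [theta_apply_of_ne μ hlo]
    exact h7
  · rw [theta_apply_of_ne μ hko]
    have : (‖t k‖ - 2) * ‖t l‖ ≤ (‖t k‖ - 2) * ‖theta μ o t o‖ :=
      mul_le_mul_of_nonneg_left (by linarith) (by linarith)
    linarith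
  · rw [theta_apply_of_ne μ hko]
    exact h.lt_three
  · linarith

/-- This is the move off the boundary path of the special region: the old value, below 3, and the
coefficient are negligible against the product of two values above `μ.bound`. -/
theorem escaping_theta_of_lt_three {μ : Param} {i j k : Fin 3} (hki : k ≠ i) (hkj : k ≠ j)
    (hij : i ≠ j) {t : Fin 3 → ℂ} (hi : μ.bound < ‖t i‖) (hj : μ.bound < ‖t j‖)
    (hk : ‖t k‖ < 3) :
    Escaping μ k (theta μ k t) ∧ ‖t i‖ + μ.bound ≤ ‖theta μ k t k‖ := by
  have h1 := le_norm_theta_apply_self μ hki hkj hij t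
  have h2 := μ.norm_coeff_le_bound k
  have h3 := norm_nonneg (μ.coeff k)
  have h4 : 8 * ‖t i‖ ≤ ‖t i‖ * ‖t j‖ := by nlinarith
  have h5 : ‖t i‖ * ‖t j‖ / 2 < ‖theta μ k t k‖ := by linarith
  refine ⟨fun m n hkm hkn hmn => ?_, by linarith⟩
  have : ∀ i j k m n : Fin 3, k ≠ i → k ≠ j → i ≠ j → k ≠ m → k ≠ n → m ≠ n →
    (m = i ∧ n = j) ∨ (m = j ∧ n = i) := by decide
  rw [theta_apply_of_ne μ hkm.symm, theta_apply_of_ne μ hkn.symm]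
  rcases this i j k m n hki hkj hij hkm hkn hmn with ⟨rfl, rfl⟩ | ⟨rfl, rfl⟩
  · exact ⟨hi, h5⟩
  · exact ⟨hj, by rwa [mul_comm]⟩

/-- The newest value is at least four times the one being replaced, so the product of the two
retained values absorbs both the replaced value and the coefficient. -/
theorem Escaping.step {μ : Param} {l m : Fin 3} (hlm : l ≠ m) {t : Fin 3 → ℂ}
    (h : Escaping μ l t) :
    Escaping μ m (theta μ m t) ∧ ‖t l‖ + μ.bound ≤ ‖theta μ m t m‖ := by
  obtain ⟨n, hln, hmn⟩ : ∃ n : Fin 3, l ≠ n ∧ m ≠ n := by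
    clear * - hlm; revert l m; decide
  have h1 := le_norm_theta_apply_self μ hlm.symm hmn hln t
  have h2 := μ.norm_coeff_le_bound m
  have h3 := norm_nonneg (μ.coeff m)
  obtain ⟨hm, hmul⟩ := h m n hlm hln hmn
  obtain ⟨hn, -⟩ := h n m hln hlm hmn.symm
  have h4 : 4 * ‖t m‖ ≤ ‖t l‖ := by nlinarith
  have h5 : 8 * ‖t l‖ ≤ ‖t l‖ * ‖t n‖ := by nlinarith [norm_nonneg (t l)]
  have h6 : ‖t l‖ * ‖t n‖ / 2 < ‖theta μ m t m‖ := by linarith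
  refine ⟨fun a b hma hmb hab => ?_, by linarith⟩
  have : ∀ i j k m n : Fin 3, k ≠ i → k ≠ j → i ≠ j → k ≠ m → k ≠ n → m ≠ n →
    (m = i ∧ n = j) ∨ (m = j ∧ n = i) := by decide
  rw [theta_apply_of_ne μ hma.symm, theta_apply_of_ne μ hmb.symm]
  rcases this l n m a b hlm.symm hmn hln hma hmb hab with ⟨rfl, rfl⟩ | ⟨rfl, rfl⟩
  · exact ⟨by linarith, h6⟩
  · exact ⟨hn, by rwa [mul_comm]⟩

/-- The triples at a vertex on a region of colour `k` such that the values on the neighbours of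
that region grow in both directions. -/
def basin (μ : Param) (k i j : Fin 3) : Set (Fin 3 → ℂ) :=
  {t | Spiral μ k i j (theta μ i t) ∧ Spiral μ k j i (theta μ j t)}

theorem isOpen_setOf_spiral (μ : Param) (k l o : Fin 3) : IsOpen {t | Spiral μ k l o t} := by
  have : {t | Spiral μ k l o t} = {t | μ.bound < ‖t o‖} ∩
      {t | (‖μ.coeff l‖ + ‖μ.coeff o‖) / 8 + ‖μ.coeff o‖ / 4 < ‖t l‖ - ‖t o‖} ∩
      {t | 7 / 8 * (‖μ.coeff l‖ + ‖μ.coeff o‖) < (‖t k‖ - 2) * ‖t l‖} ∩ {t | ‖t k‖ < 3} := by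
    ext t
    exact ⟨fun h => ⟨⟨⟨h.1, h.2⟩, h.3⟩, h.4⟩, fun h => ⟨h.1.1.1, h.1.1.2, h.1.2, h.2⟩⟩
  rw [this]
  refine (((isOpen_lt ?_ ?_).inter (isOpen_lt ?_ ?_)).inter (isOpen_lt ?_ ?_)).inter
    (isOpen_lt ?_ ?_) <;> fun_prop

theorem isOpen_basin (μ : Param) (k i j : Fin 3) : IsOpen (basin μ k i j) :=
  ((isOpen_setOf_spiral μ k i j).preimage (continuous_theta μ i)).inter
    ((isOpen_setOf_spiral μ k j i).preimage (continuous_theta μ j))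

theorem bound_lt_of_mem_basin {μ : Param} {i j k : Fin 3} (hij : i ≠ j) (hik : i ≠ k)
    {t : Fin 3 → ℂ} (ht : t ∈ basin μ k i j) :
    μ.bound < ‖t i‖ ∧ μ.bound < ‖t j‖ ∧ 2 < ‖t k‖ ∧ ‖t k‖ < 3 := by
  have h1 := ht.1.bound_lt
  have h2 := ht.2.bound_lt
  have h3 := ht.1.two_lt
  have h4 := ht.1.lt_three
  rw [theta_apply_of_ne μ hij.symm] at h1
  rw [theta_apply_of_ne μ hij] at h2
  rw [theta_apply_of_ne μ hik.symm] at h3 h4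
  exact ⟨h2, h1, h3, h4⟩

/-- A reduced path first follows the boundary of the special region in one of two directions,
possibly for no steps. The letter `k` takes it off that boundary, and since it never backtracks it
stays in the escaping state. Each step gains at least an eighth of `‖μ.coeff i‖ + ‖μ.coeff j‖`. -/
theorem growth_of_mem_basin {μ : Param} {i j k : Fin 3} (hij : i ≠ j) (hik : i ≠ k) (hjk : j ≠ k)
    {t : Fin 3 → ℂ} (ht : t ∈ basin μ k i j) (a : Fin 3) (L : List (Fin 3))
    (hL : (a :: L).IsChain (· ≠ ·)) :
    ((a = i ∧ Spiral μ k i j (run μ t (a :: L))) ∨ (a = j ∧ Spiral μ k j i (run μ t (a :: L))) ∨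
      Escaping μ a (run μ t (a :: L))) ∧
    μ.bound + (‖μ.coeff i‖ + ‖μ.coeff j‖) / 8 * (a :: L).length ≤ ‖run μ t (a :: L) a‖ := by
  have hb := μ.norm_coeff_add_le_bound hij
  have hi := norm_nonneg (μ.coeff i)
  have hj := norm_nonneg (μ.coeff j)
  induction L generalizing a with
  | nil =>
    have hcases : a = i ∨ a = j ∨ a = k := by
      clear * - hij hik hjk; revert i j k a; decide
    obtain ⟨h1, h2, -, h3⟩ := bound_lt_of_mem_basin hij hik ht
    simp only [run, List.length_cons, List.length_nil, zero_add, Nat.cast_one, mul_one]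
    rcases hcases with rfl | rfl | rfl
    · exact ⟨Or.inl ⟨rfl, ht.1⟩, ht.1.bound_lt_last.le⟩
    · exact ⟨Or.inr (Or.inl ⟨rfl, ht.2⟩), by linarith [ht.2.bound_lt_last]⟩
    · obtain ⟨h4, h5⟩ := escaping_theta_of_lt_three hik.symm hjk.symm hij h1 h2 h3
      exact ⟨Or.inr (Or.inr h4), by linarith⟩
  | cons b L ih =>
    obtain ⟨hab, hL⟩ := List.isChain_cons_cons.1 hL
    obtain ⟨hstate, hgrow⟩ := ih b hL
    rw [run]
    rw [show ((a :: b :: L).length : ℝ) = (b :: L).length + 1 by push_cast [List.length_cons]; ring]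
    generalize run μ t (b :: L) = x at *
    generalize ((b :: L).length : ℝ) = n at *
    rcases hstate with ⟨rfl, h⟩ | ⟨rfl, h⟩ | h
    · have hcases : a = j ∨ a = k := by
        clear * - hij hik hjk hab; revert b j k a; decide
      rcases hcases with rfl | rfl
      · obtain ⟨h1, h2⟩ := h.step hik.symm hjk.symm hij
        exact ⟨Or.inr (Or.inl ⟨rfl, h1⟩), by linarith⟩
      · obtain ⟨h1, h2⟩ := escaping_theta_of_lt_three hik.symm hjk.symm hij
          (by linarith [h.bound_lt_last]) h.bound_lt h.lt_three
        exact ⟨Or.inr (Or.inr h1), by linarith⟩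
    · have hcases : a = i ∨ a = k := by
        clear * - hij hik hjk hab; revert i b k a; decide
      rcases hcases with rfl | rfl
      · obtain ⟨h1, h2⟩ := h.step hjk.symm hik.symm hij.symm
        exact ⟨Or.inl ⟨rfl, h1⟩, by linarith⟩
      · obtain ⟨h1, h2⟩ := escaping_theta_of_lt_three hjk.symm hik.symm hij.symm
          (by linarith [h.bound_lt_last]) h.bound_lt h.lt_three
        exact ⟨Or.inr (Or.inr h1), by linarith⟩
    · obtain ⟨h1, h2⟩ := h.step hab.symm
      exact ⟨Or.inr (Or.inr h1), by linarith⟩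

theorem uniformBQ_basin {μ : Param} {i j k : Fin 3} (hij : i ≠ j) (hik : i ≠ k) (hjk : j ≠ k)
    (hpos : 0 < ‖μ.coeff i‖ + ‖μ.coeff j‖) : UniformBQ μ (basin μ k i j) where
  avoid t ht X := by
    have hb := μ.norm_coeff_le_bound i
    have hi := norm_nonneg (μ.coeff i)
    suffices h : 2 < ‖markoffMap μ t X‖ by
      rintro ⟨x, hx, hx'⟩
      rw [← hx', Complex.norm_real, Real.norm_eq_abs] at h
      exact absurd (abs_le.2 hx) (not_le.2 h)
    obtain ⟨l, L, hL, rfl, hl⟩ := exists_reduced_word_region X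
    rw [markoffMap_regionAt, thetaHom_vertexOf_inv]
    cases L with
    | nil =>
      obtain ⟨h1, h2, h3, -⟩ := bound_lt_of_mem_basin hij hik ht
      have hcases : l = i ∨ l = j ∨ l = k := by clear * - hij hik hjk; revert i j k l; decide
      rcases hcases with rfl | rfl | rfl <;> rw [run] <;> linarith
    | cons a L =>
      obtain rfl : a = l := hl a (by simp)
      have h1 := (growth_of_mem_basin hij hik hjk ht a L hL).2
      have : 0 ≤ (‖μ.coeff i‖ + ‖μ.coeff j‖) / 8 * (a :: L).length := by positivity
      linarith
  finite K := by
    -- Past this length the linear lower bound exceeds `K`; `N` does not depend on the triple.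
    obtain ⟨N, hN⟩ := exists_nat_gt ((K - μ.bound) / ((‖μ.coeff i‖ + ‖μ.coeff j‖) / 8))
    refine ⟨(fun x : Fin 3 × List (Fin 3) => regionAt x.1 (vertexOf x.2)) ''
      (Set.univ ×ˢ {L | L.length ≤ N}),
      (Set.finite_univ.prod (List.finite_length_le _ N)).image _, fun t ht X hX => ?_⟩
    obtain ⟨l, L, hL, rfl, hl⟩ := exists_reduced_word_region X
    refine ⟨(l, L), ⟨trivial, ?_⟩, rfl⟩
    change ‖markoffMap μ t _‖ ≤ K at hX
    rw [markoffMap_regionAt, thetaHom_vertexOf_inv] at hX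
    cases L with
    | nil => simp
    | cons a L =>
      obtain rfl : a = l := hl a (by simp)
      have h1 := (growth_of_mem_basin hij hik hjk ht a L hL).2
      rw [div_lt_iff₀ (by positivity)] at hN
      have h2 : ((a :: L).length : ℝ) < N := by
        by_contra! h
        have := mul_le_mul_of_nonneg_left h
          (show 0 ≤ (‖μ.coeff i‖ + ‖μ.coeff j‖) / 8 by positivity)
        linarith
      exact_mod_cast h2.le

/-! ### Real points -/

/-- The move preserves the sign pattern, `-(σ x)` becoming `-(σ (y u - x - a))`, so the norms are
computed exactly. -/
theorem spiral_theta_of_real {μ : Param} {i j k : Fin 3} (hij : i ≠ j) (hik : i ≠ k) (hjk : j ≠ k)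
    {t : Fin 3 → ℂ} {σ τ x y u a b : ℝ} (hσ : σ = 1 ∨ σ = -1) (hτ : τ = 1 ∨ τ = -1)
    (hti : t i = ((-(σ * x) : ℝ) : ℂ)) (htj : t j = ((-(τ * y) : ℝ) : ℂ))
    (htk : t k = ((-(σ * τ * u) : ℝ) : ℂ)) (hci : μ.coeff i = ((σ * a : ℝ) : ℂ))
    (hcj : μ.coeff j = ((τ * b : ℝ) : ℂ)) (ha : 0 ≤ a) (hb : 0 ≤ b) (hy : μ.bound < y)
    (hu : 2 < u) (hu3 : u < 3) (h1 : (a + b) / 8 + b / 4 < y * u - x - a - y)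
    (h2 : 7 / 8 * (a + b) < (u - 2) * (y * u - x - a)) :
    Spiral μ k i j (theta μ i t) := by
  have hy0 : 0 < y := by linarith [μ.norm_coeff_le_bound i, norm_nonneg (μ.coeff i)]
  have sgn : ∀ {ε v : ℝ}, ε = 1 ∨ ε = -1 → 0 ≤ v → ‖((ε * v : ℝ) : ℂ)‖ = v := by
    rintro ε v (rfl | rfl) hv <;> simp [abs_of_nonneg hv]
  have nci : ‖μ.coeff i‖ = a := by rw [hci, sgn hσ ha]
  have ncj : ‖μ.coeff j‖ = b := by rw [hcj, sgn hτ hb]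
  have ntj : ‖t j‖ = y := by rw [htj, Complex.ofReal_neg, norm_neg, sgn hτ hy0.le]
  have hστ : σ * τ = 1 ∨ σ * τ = -1 := by
    rcases hσ with rfl | rfl <;> rcases hτ with rfl | rfl <;> simp
  have ntk : ‖t k‖ = u := by rw [htk, Complex.ofReal_neg, norm_neg, sgn hστ (by linarith)]
  have nti : ‖theta μ i t i‖ = y * u - x - a := by
    have hτ2 : τ * τ = 1 := by rcases hτ with rfl | rfl <;> norm_num
    have : theta μ i t i = ((-(σ * (y * u - x - a)) : ℝ) : ℂ) := by
      rw [theta_apply_self μ hij hik hjk, hci, htj, htk, hti, ← Complex.ofReal_mul,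
        ← Complex.ofReal_sub, ← Complex.ofReal_sub]
      congr 1
      linear_combination -(σ * y * u) * hτ2
    rw [this, Complex.ofReal_neg, norm_neg, sgn hσ (by linarith)]
  constructor
  · rwa [theta_apply_of_ne μ hij.symm, ntj]
  · rwa [theta_apply_of_ne μ hij.symm, ntj, nti, nci, ncj]
  · rwa [theta_apply_of_ne μ hik.symm, ntk, nti, nci, ncj]
  · rwa [theta_apply_of_ne μ hik.symm, ntk]

/-- Real solutions of the Markoff equation in which one variable is close to `2` and the others are
large. -/
theorem exists_markoff_solution {a b : ℝ} (ha : 0 ≤ a) (hb : 0 ≤ b) (hab : 0 < a + b)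
    (c s M : ℝ) : ∃ T u : ℝ, M < T ∧ 0 < T ∧ 2 < u ∧ u < 3 ∧ 15 / 16 * (a + b) ≤ (u - 2) * T ∧
      (T + b / 2) ^ 2 + (T + a / 2) ^ 2 + u ^ 2 - (T + b / 2) * (T + a / 2) * u =
        -(a * (T + b / 2)) - b * (T + a / 2) - c * u + s := by
  -- The second condition gives `ε₂ < 1`; the third lets `(a + b) T / 16` absorb all terms of lower
  -- order in `T`.
  obtain ⟨T, hM, hT, hS⟩ : ∃ T : ℝ, M < T ∧ 2 * (a + b) < T ∧
      2 * (a + b) ^ 2 + 9 + 3 * |c| + |s| ≤ (a + b) * T / 16 := by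
    refine ⟨max (max (M + 1) (2 * (a + b) + 1))
      ((2 * (a + b) ^ 2 + 9 + 3 * |c| + |s|) * 16 / (a + b)), ?_, ?_, ?_⟩
    · exact (lt_add_one M).trans_le ((le_max_left _ _).trans (le_max_left _ _))
    · exact (lt_add_one _).trans_le ((le_max_right _ _).trans (le_max_left _ _))
    · have := le_max_right (max (M + 1) (2 * (a + b) + 1))
        ((2 * (a + b) ^ 2 + 9 + 3 * |c| + |s|) * 16 / (a + b))
      rw [div_le_iff₀ hab] at this
      linarith
  have hT0 : 0 < T := by linarith
  have habs : a * b ≤ (a + b) ^ 2 := by nlinarith [mul_nonneg ha hb, sq_nonneg a, sq_nonneg b]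
  have hab0 := mul_nonneg ha hb
  -- A zero of `f` solves the equation with `u = 2 + ε`. Its main part is `T (a + b - ε T)`, which
  -- changes sign between `ε₁` and `ε₂`.
  let f : ℝ → ℝ := fun ε => (T + b / 2 - (T + a / 2)) ^ 2 + (2 + ε) ^ 2 + a * (T + b / 2) +
    b * (T + a / 2) + c * (2 + ε) - s - ε * ((T + b / 2) * (T + a / 2))
  have hcont : Continuous f := by fun_prop
  set ε₁ := 15 / 16 * (a + b) / T with hε₁
  set ε₂ := 17 / 16 * (a + b) / T with hε₂
  have e1 : ε₁ * T = 15 / 16 * (a + b) := by rw [hε₁]; field_simp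
  have e2 : ε₂ * T = 17 / 16 * (a + b) := by rw [hε₂]; field_simp
  have p1 : 0 < ε₁ := by positivity
  have p2 : 0 < ε₂ := by positivity
  have h12 : ε₁ ≤ ε₂ := by rw [hε₁, hε₂]; gcongr; norm_num
  have l2 : ε₂ < 1 := by rw [hε₂, div_lt_one hT0]; linarith
  have l1 : ε₁ < 1 := by linarith
  have hc : ∀ ε : ℝ, 0 < ε → ε < 1 → -(3 * |c|) ≤ c * (2 + ε) ∧ c * (2 + ε) ≤ 3 * |c| := by
    intro ε h0 h1
    rw [← abs_le, abs_mul, abs_of_pos (show 0 < 2 + ε by linarith)]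
    nlinarith [abs_nonneg c]
  have hs := abs_le.1 (le_refl |s|)
  have f1 : 0 ≤ f ε₁ := by
    have : f ε₁ = (b - a) ^ 2 / 4 + (2 + ε₁) ^ 2 + (a + b) * T + a * b + c * (2 + ε₁) - s -
        (ε₁ * T) * T - (ε₁ * T) * (a + b) / 2 - ε₁ * (a * b) / 4 := by
      simp only [f]; ring
    rw [this, e1]
    have : ε₁ * (a * b) ≤ a * b := by nlinarith
    nlinarith [hc ε₁ p1 l1, sq_nonneg (b - a), sq_nonneg (2 + ε₁)]
  have f2 : f ε₂ ≤ 0 := by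
    have : f ε₂ = (b - a) ^ 2 / 4 + (2 + ε₂) ^ 2 + (a + b) * T + a * b + c * (2 + ε₂) - s -
        (ε₂ * T) * T - (ε₂ * T) * (a + b) / 2 - ε₂ * (a * b) / 4 := by
      simp only [f]; ring
    rw [this, e2]
    have : 0 ≤ ε₂ * (a * b) := by positivity
    nlinarith [hc ε₂ p2 l2]
  obtain ⟨ε, ⟨hε1, hε2⟩, hε⟩ := intermediate_value_Icc' h12 hcont.continuousOn ⟨f2, f1⟩
  refine ⟨T, 2 + ε, hM, hT0, by linarith, by linarith, ?_, ?_⟩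
  · rw [← e1]
    nlinarith
  · simp only [f] at hε
    linear_combination hε

theorem exists_real_mem_basin (p q r s : ℝ) {i j k : Fin 3} (hij : i ≠ j) (hik : i ≠ k)
    (hjk : j ≠ k) (hi : ![p, q, r] i ≠ 0) :
    ∃ t : Fin 3 → ℝ, IsMarkoffTriple ⟨p, q, r, s⟩ (fun n => (t n : ℂ)) ∧
      (fun n => (t n : ℂ)) ∈ basin ⟨p, q, r, s⟩ k i j := by
  set μ : Param := ⟨p, q, r, s⟩ with hμ
  set m : Fin 3 → ℝ := ![p, q, r] with hm
  have hcoeff : ∀ n, μ.coeff n = (m n : ℂ) := by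
    intro n; fin_cases n <;> rfl
  have hsign : ∀ v : ℝ, ∃ σ : ℝ, (σ = 1 ∨ σ = -1) ∧ v = σ * |v| := fun v => by
    rcases abs_choice v with h | h
    · exact ⟨1, Or.inl rfl, by rw [h, one_mul]⟩
    · exact ⟨-1, Or.inr rfl, by rw [h]; ring⟩
  obtain ⟨σ, hσ, hmi⟩ := hsign (m i)
  obtain ⟨τ, hτ, hmj⟩ := hsign (m j)
  have ha := abs_nonneg (m i)
  have hb := abs_nonneg (m j)
  have hab : 0 < |m i| + |m j| := by linarith [abs_pos.2 hi]
  obtain ⟨T, u, hM, hT, hu, hu3, hlow, heq⟩ :=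
    exists_markoff_solution ha hb hab (σ * τ * m k) s μ.bound
  set a := |m i| with ha'
  set b := |m j| with hb'
  let t : Fin 3 → ℝ := fun n => if n = i then -(σ * (T + b / 2)) else
    if n = j then -(τ * (T + a / 2)) else -(σ * τ * u)
  have hti : t i = -(σ * (T + b / 2)) := if_pos rfl
  have htj : t j = -(τ * (T + a / 2)) := by simp [t, hij.symm]
  have htk : t k = -(σ * τ * u) := by simp [t, hik.symm, hjk.symm]
  have hσ2 : σ * σ = 1 := by rcases hσ with rfl | rfl <;> norm_num
  have hτ2 : τ * τ = 1 := by rcases hτ with rfl | rfl <;> norm_num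
  have hci : μ.coeff i = ((σ * a : ℝ) : ℂ) := by rw [hcoeff, ← hmi]
  have hcj : μ.coeff j = ((τ * b : ℝ) : ℂ) := by rw [hcoeff, ← hmj]
  have hx : ∀ v, 0 ≤ v → 15 / 16 * (a + b) ≤ (u - 2) * (T + v) := fun v hv => by nlinarith
  refine ⟨t, ?_, ?_, ?_⟩
  · rw [isMarkoffTriple_iff μ hij hik hjk, hcoeff, hcoeff, hcoeff]
    have : t i ^ 2 + t j ^ 2 + t k ^ 2 + t i * t j * t k =
        m i * t i + m j * t j + m k * t k + s := by
      rw [hti, htj, htk, hmi, hmj]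
      linear_combination heq + ((T + b / 2) ^ 2 + a * (T + b / 2)
        - (T + b / 2) * (T + a / 2) * u * τ * τ + τ * τ * u ^ 2) * hσ2 +
        ((T + a / 2) ^ 2 + b * (T + a / 2) - (T + b / 2) * (T + a / 2) * u + u ^ 2) * hτ2
    rw [show μ.s = (s : ℂ) from rfl]
    exact_mod_cast this
  -- The shifts `a / 2` and `b / 2` balance the two directions: each first gap is `(u - 2)` times a
  -- neighbour's modulus, minus `(a + b) / 2`. It is thus at least `7/16 (a + b)`, above the
  -- required amount, which is at most `3/8 (a + b)`.
  · have h1 := hx (a / 2) (by linarith)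
    have h2 : (u - 2) * (T + a / 2) ≤
        (u - 2) * ((T + a / 2) * u - (T + b / 2) - a) :=
      mul_le_mul_of_nonneg_left (by linarith) (by linarith)
    exact spiral_theta_of_real hij hik hjk hσ hτ (congrArg _ hti) (congrArg _ htj)
      (congrArg _ htk) hci hcj ha hb (by linarith) hu hu3 (by linarith) (by linarith)
  · have h1 := hx (b / 2) (by linarith)
    have h2 : (u - 2) * (T + b / 2) ≤
        (u - 2) * ((T + b / 2) * u - (T + a / 2) - b) :=
      mul_le_mul_of_nonneg_left (by linarith) (by linarith)
    exact spiral_theta_of_real hij.symm hjk hik hτ hσ (congrArg _ htj) (congrArg _ hti)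
      (congrArg _ (htk.trans (by ring))) hcj hci hb ha (by linarith) hu hu3 (by linarith)
      (by linarith)

theorem exists_real_mem_bowditchDomain (p q r s : ℝ) (hpqr : (p, q, r) ≠ (0, 0, 0)) :
    ∃ t : Fin 3 → ℝ, (fun n => (t n : ℂ)) ∈ bowditchDomain ⟨p, q, r, s⟩ := by
  obtain ⟨i, hi⟩ : ∃ i, ![p, q, r] i ≠ 0 := by
    by_contra! h
    exact hpqr (by simpa using And.intro (h 0) (And.intro (h 1) (h 2)))
  have h1 : i ≠ i + 1 := by clear hi; revert i; decide
  have h2 : i ≠ i + 2 := by clear hi h1; revert i; decide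
  have h3 : i + 1 ≠ i + 2 := by clear hi h1 h2; revert i; decide
  obtain ⟨t, htV, ht⟩ := exists_real_mem_basin p q r s h1 h2 h3 hi
  have hcoeff : ∀ n, (⟨p, q, r, s⟩ : Param).coeff n = ((![p, q, r] n : ℝ) : ℂ) := by
    intro n; fin_cases n <;> rfl
  refine ⟨t, ⟨_, isOpen_basin _ _ _ _, ht, uniformBQ_basin h1 h2 h3 ?_⟩, htV⟩
  rw [hcoeff]
  have : 0 < ‖((![p, q, r] i : ℝ) : ℂ)‖ := norm_pos_iff.2 (by exact_mod_cast hi)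
  linarith [norm_nonneg ((⟨p, q, r, s⟩ : Param).coeff (i + 1))]

/-! ### The relative Euler class -/

theorem mulVec_direction_eq (N : Matrix (Fin 2) (Fin 2) ℝ) (t : ℝ) (w : ℂ)
    (hw : w = ⟨direction t 0 * N.mulVec (direction t) 0 + direction t 1 * N.mulVec (direction t) 1,
      direction t 0 * N.mulVec (direction t) 1 - direction t 1 * N.mulVec (direction t) 0⟩) :
    N.mulVec (direction t) = ‖w‖ • direction (t + w.arg / Real.pi) := by
  have hpi : Real.pi * (t + w.arg / Real.pi) = Real.pi * t + w.arg := by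
    field_simp
  have hre : ‖w‖ * Real.cos w.arg = w.re := Complex.norm_mul_cos_arg w
  have him : ‖w‖ * Real.sin w.arg = w.im := Complex.norm_mul_sin_arg w
  have h1 := Real.cos_sq_add_sin_sq (Real.pi * t)
  ext i
  fin_cases i
  · change N.mulVec (direction t) 0 = ‖w‖ * Real.cos _
    rw [hpi, Real.cos_add]
    have : ‖w‖ * (Real.cos (Real.pi * t) * Real.cos w.arg - Real.sin (Real.pi * t) *
      Real.sin w.arg) = Real.cos (Real.pi * t) * w.re - Real.sin (Real.pi * t) * w.im := by
      rw [← hre, ← him]; ring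
    rw [this, hw]
    generalize N.mulVec (direction t) = v
    simp only [direction, Matrix.cons_val_zero, Matrix.cons_val_one]
    linear_combination -(v 0) * h1
  · change N.mulVec (direction t) 1 = ‖w‖ * Real.sin _
    rw [hpi, Real.sin_add]
    have : ‖w‖ * (Real.sin (Real.pi * t) * Real.cos w.arg + Real.cos (Real.pi * t) *
      Real.sin w.arg) = Real.sin (Real.pi * t) * w.re + Real.cos (Real.pi * t) * w.im := by
      rw [← hre, ← him]; ring
    rw [this, hw]
    generalize N.mulVec (direction t) = v
    simp only [direction, Matrix.cons_val_zero, Matrix.cons_val_one]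
    linear_combination -(v 1) * h1

theorem direction_sq (t : ℝ) : direction t 0 ^ 2 + direction t 1 ^ 2 = 1 :=
  Real.cos_sq_add_sin_sq _

theorem continuous_direction : Continuous direction := by
  refine continuous_pi fun i => ?_
  fin_cases i
  · change Continuous fun t => Real.cos (Real.pi * t)
    fun_prop
  · change Continuous fun t => Real.sin (Real.pi * t)
    fun_prop

theorem exists_eq_smul_direction {v : Fin 2 → ℝ} (hv : v ≠ 0) :
    ∃ (c t : ℝ), c ≠ 0 ∧ v = c • direction t := by
  refine ⟨‖(⟨v 0, v 1⟩ : ℂ)‖, (⟨v 0, v 1⟩ : ℂ).arg / Real.pi, ?_, ?_⟩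
  · rw [norm_ne_zero_iff]
    intro h
    apply hv
    ext i
    fin_cases i
    · exact congrArg Complex.re h
    · exact congrArg Complex.im h
  · have h : Real.pi * ((⟨v 0, v 1⟩ : ℂ).arg / Real.pi) = (⟨v 0, v 1⟩ : ℂ).arg := by field_simp
    ext i
    fin_cases i
    · change v 0 = _ * Real.cos _
      rw [h, Complex.norm_mul_cos_arg]
    · change v 1 = _ * Real.sin _
      rw [h, Complex.norm_mul_sin_arg]

/-- The canonical lift of a hyperbolic matrix with positive trace. -/
theorem exists_lift_of_two_lt_trace {N : Matrix (Fin 2) (Fin 2) ℝ} (hdet : N.det = 1)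
    (htr : 2 < N.trace) : ∃ f : ℝ → ℝ, Continuous f ∧
      (∀ t, ∃ c : ℝ, 0 < c ∧ N.mulVec (direction t) = c • direction (f t)) ∧
      (∀ t, |f t - t| < 1) ∧ ∃ t, f t = t := by
  -- Regarding vectors as complex numbers, this is `N · direction t` times the conjugate of
  -- `direction t`; its argument is the angle by which `N` turns the direction.
  let w : ℝ → ℂ := fun t =>
    ⟨direction t 0 * N.mulVec (direction t) 0 + direction t 1 * N.mulVec (direction t) 1,
      direction t 0 * N.mulVec (direction t) 1 - direction t 1 * N.mulVec (direction t) 0⟩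
  rw [Matrix.det_fin_two] at hdet
  rw [Matrix.trace_fin_two] at htr
  have hmul : ∀ v : Fin 2 → ℝ, N.mulVec v = ![N 0 0 * v 0 + N 0 1 * v 1,
      N 1 0 * v 0 + N 1 1 * v 1] := fun v => by
    ext i; fin_cases i <;> simp [Matrix.mulVec, dotProduct, Fin.sum_univ_two]
  have hN : Continuous fun t => N.mulVec (direction t) :=
    Continuous.matrix_mulVec continuous_const continuous_direction
  have hc : ∀ i, Continuous fun t => direction t i := fun i =>
    (continuous_apply i).comp continuous_direction
  have hNc : ∀ i, Continuous fun t => N.mulVec (direction t) i := fun i =>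
    (continuous_apply i).comp hN
  have hwc : Continuous w := by
    have : w = fun t => ((direction t 0 * N.mulVec (direction t) 0 +
        direction t 1 * N.mulVec (direction t) 1 : ℝ) : ℂ) +
        ((direction t 0 * N.mulVec (direction t) 1 -
          direction t 1 * N.mulVec (direction t) 0 : ℝ) : ℂ) * Complex.I := by
      ext t : 1
      exact Complex.mk_eq_add_mul_I _ _
    rw [this]
    exact (Complex.continuous_ofReal.comp (((hc 0).mul (hNc 0)).add ((hc 1).mul (hNc 1)))).add
      ((Complex.continuous_ofReal.comp (((hc 0).mul (hNc 1)).sub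
        ((hc 1).mul (hNc 0)))).mul continuous_const)
  have eigen : ∀ (t c : ℝ), N.mulVec (direction t) = c • direction t → 0 < c := by
    intro t c h
    have h0 := congrFun h 0
    have h1 := congrFun h 1
    rw [hmul] at h0 h1
    simp only [Matrix.cons_val_zero, Matrix.cons_val_one, Pi.smul_apply, smul_eq_mul] at h0 h1
    have hchar : c ^ 2 - (N 0 0 + N 1 1) * c + 1 = 0 := by
      have hs := direction_sq t
      have e0 : (c ^ 2 - (N 0 0 + N 1 1) * c + 1) * direction t 0 = 0 := by
        linear_combination (N 1 1 - c) * h0 - N 0 1 * h1 - direction t 0 * hdet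
      have e1 : (c ^ 2 - (N 0 0 + N 1 1) * c + 1) * direction t 1 = 0 := by
        linear_combination (N 0 0 - c) * h1 - N 1 0 * h0 - direction t 1 * hdet
      linear_combination direction t 0 * e0 + direction t 1 * e1 -
        (c ^ 2 - (N 0 0 + N 1 1) * c + 1) * hs
    by_contra! hc
    nlinarith [sq_nonneg c]
  -- A real `w t` is an eigenvalue, hence positive. The argument is therefore continuous and stays
  -- strictly between `-π` and `π`.
  have hslit : ∀ t, w t ∈ Complex.slitPlane := by
    intro t
    rw [Complex.mem_slitPlane_iff]
    by_cases him : (w t).im = 0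
    · left
      refine eigen t _ ?_
      have hs := direction_sq t
      change direction t 0 * N.mulVec (direction t) 1 -
        direction t 1 * N.mulVec (direction t) 0 = 0 at him
      ext i
      fin_cases i
      · change N.mulVec (direction t) 0 = (direction t 0 * N.mulVec (direction t) 0 +
          direction t 1 * N.mulVec (direction t) 1) * direction t 0
        linear_combination -(N.mulVec (direction t) 0) * hs - direction t 1 * him
      · change N.mulVec (direction t) 1 = (direction t 0 * N.mulVec (direction t) 0 +
          direction t 1 * N.mulVec (direction t) 1) * direction t 1
        linear_combination -(N.mulVec (direction t) 1) * hs + direction t 0 * him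
    · exact Or.inr him
  have hpi := Real.pi_pos
  refine ⟨fun t => t + (w t).arg / Real.pi, ?_, fun t => ⟨‖w t‖, ?_,
    mulVec_direction_eq N t (w t) rfl⟩, fun t => ?_, ?_⟩
  · refine continuous_id.add (Continuous.div_const ?_ _)
    exact continuous_iff_continuousAt.2 fun t =>
      (Complex.continuousAt_arg (hslit t)).comp hwc.continuousAt
  · exact norm_pos_iff.2 (Complex.slitPlane_ne_zero (hslit t))
  · rw [add_sub_cancel_left, abs_div, abs_of_pos hpi, div_lt_one hpi]
    exact abs_lt.2 ⟨Complex.neg_pi_lt_arg _, lt_of_le_of_ne (Complex.arg_le_pi _)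
      (Complex.mem_slitPlane_iff_arg.1 (hslit t)).1⟩
  · have hsq : 0 ≤ (N 0 0 + N 1 1) ^ 2 - 4 := by nlinarith
    set l := (N 0 0 + N 1 1 + Real.sqrt ((N 0 0 + N 1 1) ^ 2 - 4)) / 2 with hl
    have hroot : l ^ 2 - (N 0 0 + N 1 1) * l + 1 = 0 := by
      rw [hl]
      linear_combination (1 / 4) * Real.sq_sqrt hsq
    obtain ⟨v, hv, hNv⟩ := (Matrix.exists_mulVec_eq_zero_iff (M := N - l • 1)).2 (by
      rw [Matrix.det_fin_two]
      simp
      linear_combination hroot + hdet)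
    obtain ⟨c, t, hc0, rfl⟩ := exists_eq_smul_direction hv
    refine ⟨t, ?_⟩
    have hNt : N.mulVec (direction t) = l • direction t := by
      rw [Matrix.mulVec_smul, smul_eq_zero_iff_right hc0, Matrix.sub_mulVec, Matrix.smul_mulVec,
        Matrix.one_mulVec, sub_eq_zero] at hNv
      exact hNv
    have hlpos := eigen t l hNt
    have hwt : w t = (l : ℂ) := by
      have hs := direction_sq t
      apply Complex.ext
      · change direction t 0 * N.mulVec (direction t) 0 +
          direction t 1 * N.mulVec (direction t) 1 = l
        rw [hNt]
        simp only [Pi.smul_apply, smul_eq_mul]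
        linear_combination l * hs
      · change direction t 0 * N.mulVec (direction t) 1 -
          direction t 1 * N.mulVec (direction t) 0 = 0
        rw [hNt]
        simp only [Pi.smul_apply, smul_eq_mul]
        ring
    simp [hwt, Complex.arg_ofReal_of_nonneg hlpos.le]

/-- The canonical lift of a hyperbolic element of `SL(2, ℝ)`. -/
theorem exists_lift_of_two_lt_abs_trace {A : SL(2, ℝ)}
    (htr : 2 < |(A : Matrix (Fin 2) (Fin 2) ℝ).trace|) :
    ∃ (f : ℝ → ℝ) (δ : ℝ), (δ = 1 ∨ δ = -1) ∧
      0 < δ * (A : Matrix (Fin 2) (Fin 2) ℝ).trace ∧ Continuous f ∧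
      (∀ t, ∃ c : ℝ, 0 < c ∧ (A : Matrix (Fin 2) (Fin 2) ℝ).mulVec (direction t) =
        (δ * c) • direction (f t)) ∧
      (∀ t, |f t - t| < 1) ∧ ∃ t, f t = t := by
  obtain ⟨δ, hδ, hδtr⟩ : ∃ δ : ℝ, (δ = 1 ∨ δ = -1) ∧
      2 < δ * (A : Matrix (Fin 2) (Fin 2) ℝ).trace := by
    rcases lt_abs.1 htr with h | h
    · exact ⟨1, Or.inl rfl, by linarith⟩
    · exact ⟨-1, Or.inr rfl, by linarith⟩
  have hδ2 : δ * δ = 1 := by rcases hδ with rfl | rfl <;> norm_num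
  obtain ⟨f, hf, hlift, hclose, hfix⟩ := exists_lift_of_two_lt_trace
    (N := δ • (A : Matrix (Fin 2) (Fin 2) ℝ))
    (by rw [Matrix.det_smul, A.det_coe, Fintype.card_fin]; linear_combination hδ2)
    (by rw [Matrix.trace_smul]; exact hδtr)
  refine ⟨f, δ, hδ, by linarith, hf, fun t => ?_, hclose, hfix⟩
  obtain ⟨c, hc, h⟩ := hlift t
  refine ⟨c, hc, ?_⟩
  rw [mul_smul, ← h, Matrix.smul_mulVec, smul_smul, hδ2, one_smul]

theorem exists_int_of_direction_eq_smul {s t c : ℝ} (hc : c < 0)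
    (h : direction s = c • direction t) : ∃ n : ℤ, Odd n ∧ t = s + n := by
  have h0 : Real.cos (Real.pi * s) = c * Real.cos (Real.pi * t) := congrFun h 0
  have h1 : Real.sin (Real.pi * s) = c * Real.sin (Real.pi * t) := congrFun h 1
  have hsin : Real.sin (Real.pi * t - Real.pi * s) = 0 := by
    rw [Real.sin_sub, h0, h1]; ring
  have hcos : Real.cos (Real.pi * t - Real.pi * s) = c := by
    rw [Real.cos_sub, h0, h1]
    linear_combination c * Real.cos_sq_add_sin_sq (Real.pi * t)
  obtain ⟨n, hn⟩ := Real.sin_eq_zero_iff.1 hsin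
  refine ⟨n, ?_, ?_⟩
  · rw [← Int.not_even_iff_odd]
    rintro ⟨m, rfl⟩
    rw [← hn] at hcos
    have : Real.cos (((m + m : ℤ) : ℝ) * Real.pi) = 1 := by
      rw [← Real.cos_int_mul_two_pi m]
      congr 1
      push_cast
      ring
    linarith
  · have hpi := Real.pi_pos.ne'
    apply mul_left_cancel₀ hpi
    linear_combination -hn

/-- A continuous integer-valued displacement on the line is constant. -/
theorem exists_int_forall_eq_add {F : ℝ → ℝ} (hF : Continuous F)
    (h : ∀ t, ∃ n : ℤ, Odd n ∧ F t = t + n) : ∃ n : ℤ, Odd n ∧ ∀ t, F t = t + n := by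
  choose n hodd hn using h
  have hcont : Continuous n := by
    rw [Int.isClosedEmbedding_coe_real.isEmbedding.continuous_iff]
    have : (Int.cast : ℤ → ℝ) ∘ n = fun t => F t - t := by
      ext t
      simp [hn]
    rw [this]
    fun_prop
  exact ⟨n 0, hodd 0, fun t => by rw [hn t, PreconnectedSpace.constant inferInstance hcont]⟩

/-- A product of four lifts with fixed points is not a translation by `3` or more. -/
theorem abs_translation_lt_three {f₀ f₁ f₂ f₃ : ℝ → ℝ} (hf₂ : Continuous f₂) (hf₃ : Continuous f₃)
    (h₀ : ∀ t, |f₀ t - t| < 1) (h₂ : ∀ t, |f₂ t - t| < 1) (h₃ : ∀ t, |f₃ t - t| < 1)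
    (hfix : ∃ t, f₁ t = t) {e : ℝ} (he : ∀ t, f₀ (f₁ (f₂ (f₃ t))) = t + e) : |e| < 3 := by
  obtain ⟨t₁, ht₁⟩ := hfix
  have hclose : ∀ t, |f₂ (f₃ t) - t| < 2 := fun t => by
    have := abs_add_le (f₂ (f₃ t) - f₃ t) (f₃ t - t)
    rw [sub_add_sub_cancel] at this
    linarith [h₂ (f₃ t), h₃ t]
  -- Starting where `f₂ ∘ f₃` lands on the fixed point of `f₁`, only three of the four lifts
  -- contribute displacement.
  obtain ⟨t, -, ht⟩ := intermediate_value_Icc (show t₁ - 2 ≤ t₁ + 2 by linarith)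
    (hf₂.comp hf₃).continuousOn
    (show t₁ ∈ Set.Icc ((f₂ ∘ f₃) (t₁ - 2)) ((f₂ ∘ f₃) (t₁ + 2)) from
      ⟨by have := abs_lt.1 (hclose (t₁ - 2)); simp only [Function.comp]; linarith,
        by have := abs_lt.1 (hclose (t₁ + 2)); simp only [Function.comp]; linarith⟩)
  have h1 := he t
  rw [show f₂ (f₃ t) = t₁ from ht, ht₁] at h1
  have h2 := abs_lt.1 (h₀ t₁)
  have h3 := abs_lt.1 (hclose t)
  rw [show f₂ (f₃ t) = t₁ from ht] at h3
  rw [abs_lt]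
  constructor <;> linarith

/-- Each canonical lift follows its matrix on directions up to the sign of the trace. As the
matrices multiply to 1 and the signs to `-1`, the product of the lifts reverses every direction, so
it is an odd translation. -/
theorem exists_hasRelativeEulerClass {a b c d : ℝ} {ρ : SurfaceGroup →* SL(2, ℝ)}
    (hρ : IsTauRep a b c d ρ) (ha : 2 < |a|) (hb : 2 < |b|) (hc : 2 < |c|) (hd : 2 < |d|)
    (hneg : a * b * c * d < 0) :
    HasRelativeEulerClass ρ 1 ∨ HasRelativeEulerClass ρ (-1) := by
  obtain ⟨rfl, rfl, rfl, rfl⟩ := hρ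
  obtain ⟨f₀, δ₀, hδ₀, hs₀, hf₀, hl₀, hc₀, hx₀⟩ := exists_lift_of_two_lt_abs_trace ha
  obtain ⟨f₁, δ₁, hδ₁, hs₁, hf₁, hl₁, hc₁, hx₁⟩ := exists_lift_of_two_lt_abs_trace hb
  obtain ⟨f₂, δ₂, hδ₂, hs₂, hf₂, hl₂, hc₂, hx₂⟩ := exists_lift_of_two_lt_abs_trace hc
  obtain ⟨f₃, δ₃, hδ₃, hs₃, hf₃, hl₃, hc₃, hx₃⟩ := exists_lift_of_two_lt_abs_trace hd
  have hδ : δ₀ * δ₁ * δ₂ * δ₃ < 0 := by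
    have hpos := mul_pos (mul_pos (mul_pos hs₀ hs₁) hs₂) hs₃
    by_contra! h
    have := mul_nonneg h (neg_nonneg.2 hneg.le)
    unfold tr at this
    nlinarith
  have hprod : ρ (boundary 0) * (ρ (boundary 1) * (ρ (boundary 2) * ρ (boundary 3))) = 1 := by
    rw [← map_mul, ← map_mul, ← map_mul]
    simp [boundary, ← mul_assoc]
  have hprod' := congrArg (fun A : SL(2, ℝ) => (A : Matrix (Fin 2) (Fin 2) ℝ)) hprod
  simp only [Matrix.SpecialLinearGroup.coe_mul, Matrix.SpecialLinearGroup.coe_one] at hprod'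
  obtain ⟨e, hodd, he⟩ := exists_int_forall_eq_add
    (F := fun t => f₀ (f₁ (f₂ (f₃ t)))) (hf₀.comp (hf₁.comp (hf₂.comp hf₃))) fun t => by
      obtain ⟨c₃, p₃, e₃⟩ := hl₃ t
      obtain ⟨c₂, p₂, e₂⟩ := hl₂ (f₃ t)
      obtain ⟨c₁, p₁, e₁⟩ := hl₁ (f₂ (f₃ t))
      obtain ⟨c₀, p₀, e₀⟩ := hl₀ (f₁ (f₂ (f₃ t)))
      refine exists_int_of_direction_eq_smul
        (c := δ₀ * δ₁ * δ₂ * δ₃ * (c₀ * c₁ * c₂ * c₃))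
        (mul_neg_of_neg_of_pos hδ (by positivity)) ?_
      have := congrArg (fun M : Matrix (Fin 2) (Fin 2) ℝ => M.mulVec (direction t)) hprod'
      simp only [Matrix.one_mulVec, ← Matrix.mulVec_mulVec] at this
      simp only [e₃, e₂, e₁, e₀, Matrix.mulVec_smul, smul_smul] at this
      refine this.symm.trans ?_
      congr 1
      ring
  have hlt : |(e : ℝ)| < 3 := abs_translation_lt_three hf₂ hf₃ hc₀ hc₂ hc₃ hx₁ he
  have hE : HasRelativeEulerClass ρ e := by
    refine ⟨![f₀, f₁, f₂, f₃], fun i => ?_, he⟩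
    fin_cases i
    · exact ⟨⟨hf₀, fun t => (hl₀ t).imp' _ fun _ h => h.2⟩, hx₀⟩
    · exact ⟨⟨hf₁, fun t => (hl₁ t).imp' _ fun _ h => h.2⟩, hx₁⟩
    · exact ⟨⟨hf₂, fun t => (hl₂ t).imp' _ fun _ h => h.2⟩, hx₂⟩
    · exact ⟨⟨hf₃, fun t => (hl₃ t).imp' _ fun _ h => h.2⟩, hx₃⟩
  have h3 : |e| < 3 := by exact_mod_cast hlt
  rw [abs_lt] at h3
  obtain ⟨m, rfl⟩ := hodd
  obtain rfl | rfl : m = 0 ∨ m = -1 := by omega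
  · exact Or.inl hE
  · exact Or.inr hE

/-- The matrix of a reflection. -/
def reflection : Matrix (Fin 2) (Fin 2) ℝ := !![1, 0; 0, -1]

theorem reflection_mul_self : reflection * reflection = 1 := by
  ext i j; fin_cases i <;> fin_cases j <;> simp [reflection]

theorem reflection_mulVec_direction (t : ℝ) :
    reflection.mulVec (direction t) = direction (-t) := by
  ext i; fin_cases i <;> simp [reflection, direction, Matrix.mulVec, dotProduct]

/-- Conjugation by a reflection. -/
def conjReflection : SL(2, ℝ) →* SL(2, ℝ) where
  toFun A := ⟨reflection * A * reflection, by
    rw [Matrix.det_mul, Matrix.det_mul, A.det_coe, mul_one, ← Matrix.det_mul, reflection_mul_self,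
      Matrix.det_one]⟩
  map_one' := by
    ext1 i j
    simp [reflection_mul_self]
  map_mul' A B := by
    apply Subtype.ext
    change reflection * ((A : Matrix (Fin 2) (Fin 2) ℝ) * B) * reflection =
      reflection * A * reflection * (reflection * B * reflection)
    simp only [Matrix.mul_assoc]
    rw [← Matrix.mul_assoc reflection reflection, reflection_mul_self, Matrix.one_mul]

theorem trace_conjReflection (A : SL(2, ℝ)) :
    (conjReflection A : Matrix (Fin 2) (Fin 2) ℝ).trace =
      (A : Matrix (Fin 2) (Fin 2) ℝ).trace := by
  change (reflection * (A : Matrix (Fin 2) (Fin 2) ℝ) * reflection).trace = _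
  rw [Matrix.trace_mul_comm, ← Matrix.mul_assoc, reflection_mul_self, Matrix.one_mul]

theorem IsLift.conjReflection {A : SL(2, ℝ)} {f : ℝ → ℝ} (h : IsLift A f) :
    IsLift (conjReflection A) fun t => -f (-t) := by
  refine ⟨(h.1.comp continuous_neg).neg, fun t => ?_⟩
  obtain ⟨c, hc⟩ := h.2 (-t)
  refine ⟨c, ?_⟩
  change (reflection * (A : Matrix (Fin 2) (Fin 2) ℝ) * reflection).mulVec _ = _
  rw [← Matrix.mulVec_mulVec, reflection_mulVec_direction, ← Matrix.mulVec_mulVec, hc,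
    Matrix.mulVec_smul, reflection_mulVec_direction]

theorem tr_conjReflection_comp (ρ : SurfaceGroup →* SL(2, ℝ)) (g : SurfaceGroup) :
    tr (conjReflection.comp ρ) g = tr ρ g := trace_conjReflection (ρ g)

theorem IsTauRep.conjReflection {a b c d : ℝ} {ρ : SurfaceGroup →* SL(2, ℝ)}
    (h : IsTauRep a b c d ρ) : IsTauRep a b c d (conjReflection.comp ρ) := by
  simpa only [IsTauRep, tr_conjReflection_comp] using h

theorem character_conjReflection (ρ : SurfaceGroup →* SL(2, ℝ)) :
    character (conjReflection.comp ρ) = character ρ := by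
  simp only [character, tr_conjReflection_comp]

theorem HasRelativeEulerClass.conjReflection {ρ : SurfaceGroup →* SL(2, ℝ)} {e : ℤ}
    (h : HasRelativeEulerClass ρ e) :
    HasRelativeEulerClass (conjReflection.comp ρ) (-e) := by
  obtain ⟨f, hf, he⟩ := h
  refine ⟨fun i t => -f i (-t), fun i => ⟨(hf i).1.conjReflection, ?_⟩, fun t => ?_⟩
  · obtain ⟨t, ht⟩ := (hf i).2
    exact ⟨-t, by simp only [neg_neg, ht]⟩
  · simp only [neg_neg, he]
    push_cast
    ring

/-! ### Representations with a given character -/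

/-- Off-diagonal entries of two matrices with given determinants and mixed products. -/
theorem exists_mul_eq_of_mul_eq_mul {k₁ k₂ P Q : ℝ} (h : P * Q = k₁ * k₂) :
    ∃ a₂ a₃ c₂ c₃ : ℝ, a₂ * a₃ = k₁ ∧ c₂ * c₃ = k₂ ∧ a₂ * c₃ = P ∧ a₃ * c₂ = Q := by
  by_cases h1 : k₁ = 0
  · by_cases h2 : k₂ = 0
    · subst h1 h2
      rcases mul_eq_zero.1 (h.trans (mul_zero 0)) with rfl | rfl
      · exact ⟨0, 1, Q, 0, by simp⟩
      · exact ⟨P, 0, 0, 1, by simp⟩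
    · refine ⟨P / k₂, Q, 1, k₂, ?_, by simp, by field_simp, by simp⟩
      field_simp
      linear_combination h
  · refine ⟨1, k₁, Q / k₁, P, by simp, ?_, by simp, by field_simp⟩
    field_simp
    linear_combination h

/-- Real matrices with given traces, provided that the trace of the first product is that of a
hyperbolic matrix. -/
theorem exists_matrices_of_traces {a b c d x y z : ℝ} (hx : 2 < |x|)
    (h : x ^ 2 + y ^ 2 + z ^ 2 + x * y * z = (a * b + c * d) * x + (b * c + a * d) * y +
      (a * c + b * d) * z + (4 - a ^ 2 - b ^ 2 - c ^ 2 - d ^ 2 - a * b * c * d)) :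
    ∃ A B C : Matrix (Fin 2) (Fin 2) ℝ, A.det = 1 ∧ B.det = 1 ∧ C.det = 1 ∧ A.trace = a ∧
      B.trace = b ∧ C.trace = c ∧ (A * B * C).trace = d ∧ (A * B).trace = x ∧
      (B * C).trace = y ∧ (A * C).trace = z := by
  -- These are the eigenvalues of `A B`, which will be `diag(L, l)`. The traces of `A`, `B`, `C` and
  -- `A B C` then determine the diagonals of `A` and `C` linearly.
  obtain ⟨L, l, hLl, hsum, hne⟩ : ∃ L l : ℝ, L * l = 1 ∧ L + l = x ∧ L - l ≠ 0 := by
    have hsq : 0 < x ^ 2 - 4 := by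
      have : (2 : ℝ) ^ 2 < x ^ 2 := by
        rw [← sq_abs x]
        exact pow_lt_pow_left₀ hx (by norm_num) (by norm_num)
      linarith
    refine ⟨(x + √(x ^ 2 - 4)) / 2, (x - √(x ^ 2 - 4)) / 2, ?_, by ring, ?_⟩
    · linear_combination (-1 / 4) * Real.sq_sqrt hsq.le
    · rw [show (x + √(x ^ 2 - 4)) / 2 - (x - √(x ^ 2 - 4)) / 2 = √(x ^ 2 - 4) by ring]
      exact (Real.sqrt_pos.2 hsq).ne'
  obtain ⟨a₁, a₄, ha, hb⟩ : ∃ a₁ a₄ : ℝ, a = a₁ + a₄ ∧ b = a₄ * L + a₁ * l :=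
    ⟨(a * L - b) / (L - l), (b - a * l) / (L - l), by field_simp; ring, by field_simp; ring⟩
  obtain ⟨c₁, c₄, hc, hd⟩ : ∃ c₁ c₄ : ℝ, c = c₁ + c₄ ∧ d = L * c₁ + l * c₄ :=
    ⟨(d - c * l) / (L - l), (c * L - d) / (L - l), by field_simp; ring, by field_simp; ring⟩
  obtain ⟨P, Q, hz, hy⟩ : ∃ P Q : ℝ, z = P + Q + a₁ * c₁ + a₄ * c₄ ∧
      y = a₄ * c₁ * L + a₁ * c₄ * l - l * P - L * Q := by
    refine ⟨(L * (z - a₁ * c₁ - a₄ * c₄) - (a₄ * c₁ * L + a₁ * c₄ * l - y)) / (L - l),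
      (a₄ * c₁ * L + a₁ * c₄ * l - y - l * (z - a₁ * c₁ - a₄ * c₄)) / (L - l), ?_, ?_⟩
    · field_simp; ring
    · field_simp; ring
  -- With `P = a₂ c₃` and `Q = a₃ c₂`, this is what the Markoff equation becomes: the compatibility
  -- of the off-diagonal entries with determinant 1.
  have hPQ : P * Q = (a₁ * a₄ - 1) * (c₁ * c₄ - 1) := by
    have : (L - l) ^ 2 * (P * Q - (a₁ * a₄ - 1) * (c₁ * c₄ - 1)) = 0 := by
      subst ha hb hc hd hz hy hsum
      linear_combination (4 - (a₁ + a₄) ^ 2 - (c₁ + c₄) ^ 2 - (P + Q) ^ 2 +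
        (P + Q) * (a₁ * c₄ + a₄ * c₁ - a₁ * c₁ - a₄ * c₄) + a₁ * a₄ * (c₁ ^ 2 + c₄ ^ 2) +
        c₁ * c₄ * (a₁ ^ 2 + a₄ ^ 2)) * hLl - h
    exact sub_eq_zero.1 ((mul_eq_zero.1 this).resolve_left (pow_ne_zero 2 hne))
  obtain ⟨a₂, a₃, c₂, c₃, h1, h2, h3, h4⟩ := exists_mul_eq_of_mul_eq_mul hPQ
  -- The second matrix is `A⁻¹ · diag(L, l)`.
  refine ⟨!![a₁, a₂; a₃, a₄], !![a₄ * L, -a₂ * l; -a₃ * L, a₁ * l], !![c₁, c₂; c₃, c₄],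
    ?_, ?_, ?_, ?_, ?_, ?_, ?_, ?_, ?_, ?_⟩ <;>
    simp only [Matrix.det_fin_two_of, Matrix.mul_fin_two, Matrix.trace_fin_two_of]
  · linear_combination -h1
  · linear_combination (a₁ * a₄ - a₂ * a₃) * hLl - h1
  · linear_combination -h2
  · exact ha.symm
  · exact hb.symm
  · exact hc.symm
  · rw [hd]
    linear_combination -(L * c₁ + l * c₄) * h1
  · rw [← hsum]
    linear_combination -(L + l) * h1
  · rw [hy]
    linear_combination -l * h3 - L * h4
  · rw [hz]
    linear_combination h3 + h4

theorem exists_isTauRep_of_isMarkoffTriple {a b c d : ℝ} {t : Fin 3 → ℝ} (h0 : 2 < |t 0|)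
    (ht : IsMarkoffTriple (paramOf a b c d) fun n => (t n : ℂ)) :
    ∃ ρ : SurfaceGroup →* SL(2, ℝ), IsTauRep a b c d ρ ∧ character ρ = fun n => (t n : ℂ) := by
  have h : t 0 ^ 2 + t 1 ^ 2 + t 2 ^ 2 + t 0 * t 1 * t 2 = (a * b + c * d) * t 0 +
      (b * c + a * d) * t 1 + (a * c + b * d) * t 2 +
      (4 - a ^ 2 - b ^ 2 - c ^ 2 - d ^ 2 - a * b * c * d) := by
    simp only [IsMarkoffTriple, paramOf] at ht
    exact_mod_cast ht
  obtain ⟨A, B, C, hA, hB, hC, ha, hb, hc, hd, hx, hy, hz⟩ := exists_matrices_of_traces h0 h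
  have hinv : ∀ M : SL(2, ℝ), ((M⁻¹ : SL(2, ℝ)) : Matrix (Fin 2) (Fin 2) ℝ).trace =
      (M : Matrix (Fin 2) (Fin 2) ℝ).trace := fun M => by
    rw [Matrix.SpecialLinearGroup.coe_inv, Matrix.adjugate_fin_two, Matrix.trace_fin_two_of,
      Matrix.trace_fin_two, add_comm]
  obtain ⟨A, rfl⟩ : ∃ M : SL(2, ℝ), (M : Matrix (Fin 2) (Fin 2) ℝ) = A := ⟨⟨A, hA⟩, rfl⟩
  obtain ⟨B, rfl⟩ : ∃ M : SL(2, ℝ), (M : Matrix (Fin 2) (Fin 2) ℝ) = B := ⟨⟨B, hB⟩, rfl⟩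
  obtain ⟨C, rfl⟩ : ∃ M : SL(2, ℝ), (M : Matrix (Fin 2) (Fin 2) ℝ) = C := ⟨⟨C, hC⟩, rfl⟩
  have h0 : FreeGroup.lift ![A, B, C] (FreeGroup.of 0) = A := by simp
  have h1 : FreeGroup.lift ![A, B, C] (FreeGroup.of 1) = B := by simp
  have h2 : FreeGroup.lift ![A, B, C] (FreeGroup.of 2) = C := by simp
  generalize FreeGroup.lift ![A, B, C] = ρ at h0 h1 h2
  subst h0 h1 h2
  refine ⟨ρ, ⟨ha, hb, hc, ?_⟩, ?_⟩
  · change ((ρ (FreeGroup.of 0 * FreeGroup.of 1 * FreeGroup.of 2)⁻¹ : SL(2, ℝ)) :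
      Matrix (Fin 2) (Fin 2) ℝ).trace = d
    rw [map_inv, hinv, map_mul, map_mul, Matrix.SpecialLinearGroup.coe_mul,
      Matrix.SpecialLinearGroup.coe_mul, hd]
  · have htr : ∀ g h, tr ρ (g * h) = ((ρ g : Matrix (Fin 2) (Fin 2) ℝ) * ρ h).trace :=
      fun g h => by rw [tr, map_mul, Matrix.SpecialLinearGroup.coe_mul]
    ext i
    simp only [character, htr]
    fin_cases i
    · exact congrArg Complex.ofReal hx
    · exact congrArg Complex.ofReal hy
    · exact congrArg Complex.ofReal hz

end FourHoledSphere

theorem theorem5 (p q r s : ℝ) (hpqr : (p, q, r) ≠ (0, 0, 0)) :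
    -- there is a real Markoff map satisfying the BQ-conditions
    (∃ φ : FourHoledSphere.Region → ℂ,
      FourHoledSphere.IsMarkoffMap ⟨p, q, r, s⟩ φ ∧ FourHoledSphere.IsRealMap φ ∧
      ∀ K : ℝ, FourHoledSphere.SatisfiesBQ K φ) ∧
    -- there is a domain of discontinuity, consisting of points that satisfy the BQ-conditions,
    -- that meets the real relative character varieties
    ∃ U : Set (Fin 3 → ℂ), FourHoledSphere.IsDomainOfDiscontinuity ⟨p, q, r, s⟩ U ∧
      (∀ t ∈ U, FourHoledSphere.IsBowditchTriple ⟨p, q, r, s⟩ t) ∧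
      (∃ x y z : ℝ, ![(x : ℂ), (y : ℂ), (z : ℂ)] ∈ U) ∧
      ∀ a b c d : ℝ, FourHoledSphere.paramOf a b c d = ⟨p, q, r, s⟩ →
        (∃ ρ : FourHoledSphere.SurfaceGroup →* Matrix.SpecialLinearGroup (Fin 2) ℝ,
          FourHoledSphere.IsTauRep a b c d ρ ∧ FourHoledSphere.character ρ ∈ U) ∧
        -- in particular in components with non-maximal relative Euler class
        (2 < |a| → 2 < |b| → 2 < |c| → 2 < |d| → a * b * c * d < 0 →
          ∀ e : ℤ, (e = 1 ∨ e = -1) →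
            ∃ ρ : FourHoledSphere.SurfaceGroup →* Matrix.SpecialLinearGroup (Fin 2) ℝ,
              FourHoledSphere.IsTauRep a b c d ρ ∧
              FourHoledSphere.HasRelativeEulerClass ρ e ∧ FourHoledSphere.character ρ ∈ U) := by
  obtain ⟨t, ht⟩ := FourHoledSphere.exists_real_mem_bowditchDomain p q r s hpqr
  have htV := FourHoledSphere.isMarkoffTriple_of_mem_bowditchDomain ht
  have hmap := FourHoledSphere.isMarkoffMap_markoffMap htV
  have hreal := FourHoledSphere.isRealMap_markoffMap p q r s t
  have hBQ := FourHoledSphere.satisfiesBQ_of_mem_bowditchDomain ht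
  have hU := FourHoledSphere.isDomainOfDiscontinuity_bowditchDomain ⟨_, ht⟩
  refine ⟨⟨_, hmap, hreal, hBQ⟩, _, hU, ?_, ⟨t 0, t 1, t 2, ?_⟩, fun a b c d hμ => ?_⟩
  · intro x hx
    exact FourHoledSphere.isBowditchTriple_of_mem_bowditchDomain hx
  · convert ht using 1
    ext n
    fin_cases n <;> rfl
  -- The first BQ-condition at a base region supplies the hyperbolicity of `αβ`; the constant `0` is
  -- irrelevant to it.
  have h0 : 2 < |t 0| := by
    by_contra! h
    refine (hBQ 0).bq_one (FourHoledSphere.regionAt 0 1) ⟨t 0, abs_le.1 h, ?_⟩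
    rw [FourHoledSphere.markoffMap_regionAt, inv_one, FourHoledSphere.thetaHom_one]
  rw [← hμ] at htV
  obtain ⟨ρ, hρ, hchar⟩ := FourHoledSphere.exists_isTauRep_of_isMarkoffTriple h0 htV
  rw [← hchar] at ht
  refine ⟨⟨ρ, hρ, ht⟩, fun ha hb hc hd hneg e he => ?_⟩
  have ht' := ht
  rw [← FourHoledSphere.character_conjReflection] at ht'
  rcases FourHoledSphere.exists_hasRelativeEulerClass hρ ha hb hc hd hneg with h | h <;>
    rcases he with rfl | rfl
  · exact ⟨ρ, hρ, h, ht⟩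
  · exact ⟨_, hρ.conjReflection, h.conjReflection, ht'⟩
  · exact ⟨_, hρ.conjReflection, h.conjReflection, ht'⟩
  · exact ⟨ρ, hρ, h, ht⟩
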